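/- Let $\mathcal P$ be the set of isomorphism classes of finite posets that contain no induced subposet isomorphic to the disjoint union of two $2$-element chains (unlabeled $(2+2)$-free posets, including the empty one). For such a $P$ the distinct strict principal down-sets $D(p)=\{q: q<p\}$, $p\in P$, form a chain $\emptyset=D_0\subset D_1\subset\dots\subset D_k$; an element $p$ has level $i$ if $D(p)=D_i$. Put $\mathrm{size}(P)=|P|$, $\mathrm{levels}(P)=k$, let $\mathrm{minmax}(P)$ be the smallest level of a maximal element, and $\min(P)$ the number of minimal elements; for the empty poset all these are $0$. The poset is decomposed by repeating the following step: choose a maximal element $m$ on the lowest possible level $i$; if $m$ is the only element on level $i$ and $i<k$, delete all relations $q<p$ with $q\in D_{i+1}\setminus D_i$; then remove $m$. Let $\mathrm{lds}(P)=0$ if $P$ is an antichain, and otherwise let $\mathrm{lds}(P)$ be the largest size of an antichain that is reached in this decomposition. Let $$G(t,u,v,z,x)=\sum_{P\in\mathcal P}t^{\mathrm{size}(P)}u^{\mathrm{levels}(P)}v^{\mathrm{minmax}(P)}z^{\min(P)}x^{\mathrm{lds}(P)} .$$ For $k\ge 1$ let $$\delta_k=u-(1-t)^k(u-1),\qquad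 \gamma_k=u-(1-zt)(1-t)^{k-1}(u-1),$$ $$\bar\delta_k=uv-(1-t)^k(uv-1),\qquad \bar\gamma_k=uv-(1-zt)(1-t)^{k-1}(uv-1),$$ and $\delta_0=\gamma_0=\bar\delta_0=\bar\gamma_0=1$. Then, in the ring $\mathbb Z[[t,u,v,z,x]]$ of formal power series, all the denominators below are invertible, both infinite series converge (coefficientwise), and $$G(t,u,v,z,x)=\frac1{1-tz}+\frac{t^2zxu}{(1-tzx)(v\delta_1-1)}\Biggl(v(v-1)+t(1-u)\bigl(z(v-1)-v\bigr)\sum_{s\ge0}\frac{u^s(1-t)^s}{\delta_s\delta_{s+1}\prod_{i=1}^{s+1}\gamma_i}+uv^3t(1-uv)\sum_{s\ge0}\frac{(uv)^s(1-t)^s}{\bar\delta_s\bar\delta_{s+1}\prod_{i=1}^{s+1}\bar\gamma_i}\Biggr).$$ Moreover $$G(t,u,v,z,x)=\sum_{w}t^{\mathrm{length}(w)}u^{\mathrm{asc}(w)}v^{\mathrm{last}(w)}z^{\mathrm{zeros}(w)}x^{\mathrm{run}(w)},$$ where $w$ runs over all ascent sequences, i.e. sequences $w=(x_1,\dots,x_n)$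 of non-negative integers, $n\ge 0$, with $x_1=0$ and $x_i\le 1+\mathrm{asc}(x_1,\dots,x_{i-1})$ for $2\le i\le n$. Here $\mathrm{asc}$ is the number of positions $j$ with $x_j<x_{j+1}$, $\mathrm{last}(w)=x_n$ ($0$ for the empty sequence), $\mathrm{zeros}(w)$ is the number of letters $0$, and $\mathrm{run}(w)$ is the number of zeros to the left of the leftmost non-zero letter ($0$ if there is no such letter). -/

import Mathlib

open scoped MvPowerSeries.WithPiTopology

noncomputable section

namespace TwoPlusTwo

/-! ### Posets without an induced `2 + 2`, and their statistics -/

/-- `P` has no induced subposet isomorphic to the disjoint union of two 2-element chains. -/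
def IsFree (P : Type*) [PartialOrder P] : Prop :=
  IsEmpty ((Fin 2 ⊕ Fin 2) ↪o P)

/-- The set `{D(x) : x ∈ P}` of all strict principal down-sets `D(x) = {y | y < x}`. -/
def downSets (P : Type*) [PartialOrder P] : Set (Set P) :=
  Set.range fun x : P => Set.Iio x

/-- The level of `x`: the index of `D(x)` in the chain `∅ = D₀ ⊂ D₁ ⊂ ⋯ ⊂ D_k` of all strict
principal down-sets, that is, the number of those properly contained in `D(x)`. -/
def level {P : Type*} [PartialOrder P] (x : P) : ℕ :=
  {D ∈ downSets P | D ⊂ Set.Iio x}.ncard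

/-- The number `k`, where `D₀ ⊂ D₁ ⊂ ⋯ ⊂ D_k` are all the strict principal down-sets
(so the trivial level `0` is not counted); it is `0` for the empty poset. -/
def levels (P : Type*) [PartialOrder P] : ℕ :=
  (downSets P).ncard - 1

/-- The least level of a maximal element; it is `0` for the empty poset. -/
def minmax (P : Type*) [PartialOrder P] : ℕ :=
  sInf (level '' {x : P | IsMax x})

/-- The number of minimal elements. -/
def minCount (P : Type*) [PartialOrder P] : ℕ :=
  {x : P | IsMin x}.ncard

/-- The down-set `D_i`, shared by all elements on level `i` (empty if there is no level `i`). -/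
def downSet (P : Type*) [PartialOrder P] (i : ℕ) : Set P :=
  {y | ∃ x : P, level x = i ∧ y < x}

/-- The set of elements that lose everything above them when the maximal element `m` is removed:
`D_{i+1} \ D_i` if `m` is alone on its level `i` and this is not the top level, and `∅` otherwise
(if `i` is the top level, then `downSet P (i + 1) = ∅`). -/
def uncovered {P : Type*} [PartialOrder P] (m : P) : Set P :=
  {y | (∀ w : P, level w = level m → w = m) ∧
    y ∈ downSet P (level m + 1) \ downSet P (level m)}

/-- One step of the decomposition: `Q` is (isomorphic to) the poset obtained from `P` by choosing
a maximal element `m` on the lowest possible level, deleting all relations `y < w` with `y` in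
`uncovered m`, and removing `m`. -/
def Removal (P Q : FinPartOrd.{0}) : Prop :=
  ∃ m : P, IsMax m ∧ level m = minmax P ∧
    ∃ e : Q ≃ {p : P // p ≠ m},
      ∀ a b : Q, a < b ↔ ((e a : P) < (e b : P) ∧ (e a : P) ∉ uncovered m)

/-- `P` is an antichain. -/
def IsAntichainPoset (P : Type*) [PartialOrder P] : Prop :=
  IsAntichain (· ≤ ·) (Set.univ : Set P)

open Classical in
/-- The largest size of an antichain that is reached when `P` is decomposed step by step;
`0` if `P` is itself an antichain. -/
def lds (P : FinPartOrd.{0}) : ℕ :=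
  if IsAntichainPoset P then 0
  else sSup {k | ∃ Q : FinPartOrd.{0}, Relation.ReflTransGen Removal P Q ∧
    IsAntichainPoset Q ∧ Nat.card Q = k}

/-- Isomorphism of finite posets. -/
def isoSetoid : Setoid FinPartOrd.{0} where
  r P Q := Nonempty (P ≃o Q)
  iseqv :=
    { refl := fun P => ⟨OrderIso.refl P⟩
      symm := fun ⟨e⟩ => ⟨e.symm⟩
      trans := fun ⟨e⟩ ⟨f⟩ => ⟨e.trans f⟩ }

/-- Unlabeled finite posets. -/
def UnlabeledPoset : Type 1 := Quotient isoSetoid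

/-- The generating function of unlabeled `(2+2)`-free posets. The variables `0, 1, 2, 3, 4` mark
the size, `levels`, `minmax`, the number of minimal elements and `lds`: the coefficient of a
monomial is the number of isomorphism classes of posets with these values of the statistics. -/
def posetGF : MvPowerSeries (Fin 5) ℤ := fun d =>
  (((fun P => (Quotient.mk isoSetoid P : UnlabeledPoset)) ''
    {P : FinPartOrd.{0} | IsFree P ∧ Nat.card P = d 0 ∧ levels P = d 1 ∧ minmax P = d 2 ∧
      minCount P = d 3 ∧ lds P = d 4}).ncard : ℤ)

/-! ### Ascent sequences and their statistics -/

/-- The number of ascents, i.e. of positions `j` with `x_j < x_{j+1}`. -/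
def asc (w : List ℕ) : ℕ :=
  (w.zip w.tail).countP fun p => p.1 < p.2

/-- `w = (x₁, …, x_n)` with `x₁ = 0` and `x_i ≤ 1 + asc (x₁, …, x_{i-1})` for `2 ≤ i ≤ n`; the
empty sequence is included. -/
def IsAscentSeq (w : List ℕ) : Prop :=
  ∀ i : ℕ, ∀ h : i < w.length, w[i] ≤ if i = 0 then 0 else 1 + asc (w.take i)

/-- The number of zeros to the left of the leftmost non-zero letter; `0` if all letters are
zero. -/
def run (w : List ℕ) : ℕ :=
  if ∀ a ∈ w, a = 0 then 0 else (w.takeWhile (· = 0)).length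

/-- The generating function of ascent sequences. The variables `0, 1, 2, 3, 4` mark the length,
the number of ascents, the last letter (`0` for the empty sequence), the number of zeros and the
initial run of zeros. -/
def ascentGF : MvPowerSeries (Fin 5) ℤ := fun d =>
  ({w : List ℕ | IsAscentSeq w ∧ w.length = d 0 ∧ asc w = d 1 ∧ w.getLastD 0 = d 2 ∧
    w.count 0 = d 3 ∧ run w = d 4}.ncard : ℤ)

/-! ### The ingredients of the formula -/

/-- `δ_k = u - (1 - t)^k (u - 1)`; in particular `δ_0 = 1`. -/
def delta {R : Type*} [CommRing R] (t u : R) (k : ℕ) : R :=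
  u - (1 - t) ^ k * (u - 1)

/-- `γ_k = u - (1 - z t) (1 - t)^{k-1} (u - 1)` for `k ≥ 1`, and `γ_0 = 1`. -/
def gamma {R : Type*} [CommRing R] (t u z : R) (k : ℕ) : R :=
  if k = 0 then 1 else u - (1 - z * t) * (1 - t) ^ (k - 1) * (u - 1)

/-- The denominator `δ_s δ_{s+1} ∏_{i=1}^{s+1} γ_i`. -/
def denom {R : Type*} [CommRing R] (t u z : R) (s : ℕ) : R :=
  delta t u s * delta t u (s + 1) * ∏ i ∈ Finset.Icc 1 (s + 1), gamma t u z i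

/-- The summand `u^s (1 - t)^s / (δ_s δ_{s+1} ∏_{i=1}^{s+1} γ_i)`. -/
def term {R : Type*} [CommRing R] (t u z : R) (s : ℕ) : R :=
  u ^ s * (1 - t) ^ s * Ring.inverse (denom t u z s)

end TwoPlusTwo

end

/-!
A `(2+2)`-free poset is an interval order, and the intervals from the level of an element to its
last avoided down-set give its unique representation in which every index is both a left and a
right end point. Removing the lowest maximal element deletes one interval `[i, k]` and, if nothing
else starts at `i`, the index `i`; the deletion is reversible once `i` is known, and the numbers
`i` that can occur are exactly the letters that may be appended to an ascent sequence. Thus the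
levels of the removed elements spell an ascent sequence, and under this bijection the antichains of
the decomposition are the initial runs of zeros.

For the ascent sequences with a non-zero letter, summing over the last letter gives
`(v δ₁ - 1) M(u, v) = (v - 1) u v S + t (z (v - 1) - v) M(u, 1) + t u v² M(u v, 1)`
with an explicit `S`. The substitution `v = 1 / δ₁` relates `M(u, 1)` to `M(u / δ₁, 1)`. Since
replacing `u` by `u / δ_N` turns `1 / δ₁` into `δ_N / δ_{N+1}`, the iteration telescopes into a
series for `M(u, 1)`, and the functional equation then determines `M(u, v)`.
-/

noncomputable section

namespace TwoPlusTwo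

/-! ### Fishburn multisets of intervals -/

/-- The multisets of intervals `[a, b]` in `{0, …, n - 1}` in which every index is a left end point
and a right end point. The multiplicities form an upper triangular matrix without zero rows and
columns, that is, a Fishburn matrix. -/
structure IsFishburn (n : ℕ) (s : Multiset (ℕ × ℕ)) : Prop where
  fst_le_snd : ∀ p ∈ s, p.1 ≤ p.2
  snd_lt : ∀ p ∈ s, p.2 < n
  exists_fst : ∀ j < n, ∃ p ∈ s, p.1 = j
  exists_snd : ∀ j < n, ∃ p ∈ s, p.2 = j

/-- The number `n` of indices in a Fishburn multiset of intervals in `{0, …, n - 1}`. -/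
def height (s : Multiset (ℕ × ℕ)) : ℕ := (s.map fun p => p.2 + 1).sup

/-- The least left end point of an interval ending at the last index; it is `0` if there are no
intervals. -/
def lowTop (s : Multiset (ℕ × ℕ)) : ℕ := sInf {a | (a, height s - 1) ∈ s}

/-- The effect on an interval in `{0, …, n - 1}` of inserting a new index before `i`. The right end
point `n - 1` of an interval starting before `i` becomes `i`, so that no such interval ends at the
new last index `n`. -/
def shiftInterval (n i : ℕ) (p : ℕ × ℕ) : ℕ × ℕ :=
  if p.1 < i then (p.1, if p.2 < i then p.2 else if p.2 + 1 = n then i else p.2 + 1)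
  else (p.1 + 1, p.2 + 1)

/-- The effect of deleting the index `i` from `{0, …, n}`; inverse to `shiftInterval n i`. -/
def unshiftInterval (n i : ℕ) (p : ℕ × ℕ) : ℕ × ℕ :=
  if p.1 < i then (p.1, if p.2 < i then p.2 else if p.2 = i then n - 1 else p.2 - 1)
  else (p.1 - 1, p.2 - 1)

/-- Add an interval that starts at `i` and ends at the last index, so that `i` becomes the least
left end point of such an interval. If it is not so otherwise, a new index `i` is inserted. -/
def addTop (i : ℕ) (s : Multiset (ℕ × ℕ)) : Multiset (ℕ × ℕ) :=
  if i < height s ∧ i ≤ lowTop s then (i, height s - 1) ::ₘ s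
  else (i, height s) ::ₘ s.map (shiftInterval (height s) i)

/-- Remove the longest interval ending at the last index, and the index at which it starts if no
other interval starts there. -/
def dropTop (s : Multiset (ℕ × ℕ)) : Multiset (ℕ × ℕ) :=
  let u := s.erase (lowTop s, height s - 1)
  if lowTop s ∈ u.map Prod.fst then u else u.map (unshiftInterval (height s - 1) (lowTop s))

theorem unshiftInterval_shiftInterval {n : ℕ} {p : ℕ × ℕ} (hp : p.1 ≤ p.2) (hn : p.2 < n) (i : ℕ) :
    unshiftInterval n i (shiftInterval n i p) = p := by
  obtain ⟨a, b⟩ := p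
  simp only [unshiftInterval, shiftInterval]
  grind

theorem shiftInterval_unshiftInterval {n i : ℕ} {p : ℕ × ℕ} (hp : p.1 ≤ p.2) (hpi : p.1 ≠ i)
    (hn : p.2 ≤ n) (hlow : p.2 = n → i ≤ p.1) :
    shiftInterval n i (unshiftInterval n i p) = p := by
  obtain ⟨a, b⟩ := p
  simp only [unshiftInterval, shiftInterval]
  grind

/-- An interval ending at the deleted index loses everything to its right. -/
theorem unshiftInterval_lt_iff {n i : ℕ} {p q : ℕ × ℕ} (hp : p.1 ≤ p.2) (hpi : p.1 ≠ i)
    (hpn : p.2 ≤ n) (hqi : q.1 ≠ i) (hqn : q.1 ≤ n) (hlow : p.2 = n → i ≤ p.1) :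
    (unshiftInterval n i p).2 < (unshiftInterval n i q).1 ↔ p.2 < q.1 ∧ p.2 ≠ i := by
  obtain ⟨a, b⟩ := p
  obtain ⟨c, d⟩ := q
  simp only [unshiftInterval] at *
  grind

theorem shiftInterval_fst_ne (n i : ℕ) (p : ℕ × ℕ) : (shiftInterval n i p).1 ≠ i := by
  grind [shiftInterval]

namespace IsFishburn

variable {n i : ℕ} {s : Multiset (ℕ × ℕ)}

theorem zero : IsFishburn 0 0 := by constructor <;> simp

theorem height_eq (h : IsFishburn n s) : height s = n := by
  apply le_antisymm
  · simp only [height, Multiset.sup_le, Multiset.mem_map]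
    rintro b ⟨p, hp, rfl⟩
    exact h.snd_lt p hp
  · cases n with
    | zero => exact Nat.zero_le _
    | succ k =>
      obtain ⟨p, hp, rfl⟩ := h.exists_snd k k.lt_succ_self
      exact Multiset.le_sup (Multiset.mem_map_of_mem (fun p : ℕ × ℕ => p.2 + 1) hp)

theorem lowTop_mem (h : IsFishburn n s) (hn : 0 < n) : (lowTop s, n - 1) ∈ s := by
  obtain ⟨p, hp, hpn⟩ := h.exists_snd (n - 1) (by omega)
  have hmem := Nat.sInf_mem (s := {a | (a, height s - 1) ∈ s})
    ⟨p.1, by rw [h.height_eq, ← hpn]; exact hp⟩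
  rwa [Set.mem_ofPred_eq, ← lowTop, h.height_eq] at hmem

theorem lowTop_le (h : IsFishburn n s) {p : ℕ × ℕ} (hp : p ∈ s) (hpn : p.2 + 1 = n) :
    lowTop s ≤ p.1 :=
  Nat.sInf_le (by rwa [Set.mem_ofPred_eq, h.height_eq, ← hpn, Nat.add_sub_cancel])

theorem lowTop_lt (h : IsFishburn n s) (hn : 0 < n) : lowTop s < n :=
  (h.fst_le_snd _ (h.lowTop_mem hn)).trans_lt (h.snd_lt _ (h.lowTop_mem hn))

theorem lowTop_eq (h : IsFishburn n s) {a : ℕ} (ha : (a, n - 1) ∈ s)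
    (hle : ∀ p ∈ s, p.2 + 1 = n → a ≤ p.1) : lowTop s = a := by
  have hn := h.snd_lt _ ha
  exact le_antisymm (h.lowTop_le ha (by omega)) (hle _ (h.lowTop_mem (by omega)) (by omega))

theorem addTop_of_le (h : IsFishburn n s) (hi : i < n ∧ i ≤ lowTop s) :
    addTop i s = (i, n - 1) ::ₘ s := by
  rw [addTop, h.height_eq, if_pos hi]

theorem addTop_of_not_le (h : IsFishburn n s) (hi : ¬(i < n ∧ i ≤ lowTop s)) :
    addTop i s = (i, n) ::ₘ s.map (shiftInterval n i) := by
  rw [addTop, h.height_eq, if_neg hi]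

theorem isFishburn_addTop_of_le (h : IsFishburn n s) (hi : i < n ∧ i ≤ lowTop s) :
    IsFishburn n (addTop i s) := by
  rw [h.addTop_of_le hi]
  refine ⟨?_, ?_, fun j hj => ?_, fun j hj => ?_⟩
  · exact Multiset.forall_mem_cons.2 ⟨Nat.le_sub_one_of_lt hi.1, h.fst_le_snd⟩
  · exact Multiset.forall_mem_cons.2 ⟨Nat.sub_one_lt_of_lt hi.1, h.snd_lt⟩
  · obtain ⟨p, hp, hj⟩ := h.exists_fst j hj
    exact ⟨p, Multiset.mem_cons_of_mem hp, hj⟩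
  · obtain ⟨p, hp, hj⟩ := h.exists_snd j hj
    exact ⟨p, Multiset.mem_cons_of_mem hp, hj⟩

theorem isFishburn_addTop_of_not_le (h : IsFishburn n s) (hin : i ≤ n)
    (hi : ¬(i < n ∧ i ≤ lowTop s)) : IsFishburn (n + 1) (addTop i s) := by
  rw [h.addTop_of_not_le hi]
  have hmem : ∀ p ∈ s, shiftInterval n i p ∈ (i, n) ::ₘ s.map (shiftInterval n i) :=
    fun p hp => Multiset.mem_cons_of_mem (Multiset.mem_map_of_mem _ hp)
  have hnew := Multiset.mem_cons_self (i, n) (s.map (shiftInterval n i))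
  refine ⟨?_, ?_, fun j hj => ?_, fun j hj => ?_⟩
  · rw [Multiset.forall_mem_cons, Multiset.forall_mem_map_iff]
    exact ⟨hin, fun p hp => by grind [shiftInterval, h.fst_le_snd p hp]⟩
  · rw [Multiset.forall_mem_cons, Multiset.forall_mem_map_iff]
    exact ⟨n.lt_succ_self, fun p hp => by grind [shiftInterval, h.snd_lt p hp]⟩
  · rcases lt_trichotomy j i with hji | rfl | hji
    · obtain ⟨p, hp, hj⟩ := h.exists_fst j (by omega)
      exact ⟨_, hmem p hp, by grind [shiftInterval]⟩
    · exact ⟨_, hnew, rfl⟩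
    · obtain ⟨p, hp, hj⟩ := h.exists_fst (j - 1) (by omega)
      exact ⟨_, hmem p hp, by grind [shiftInterval]⟩
  · rcases (Nat.lt_succ_iff.1 hj).eq_or_lt with rfl | hjn
    · exact ⟨_, hnew, rfl⟩
    rcases lt_trichotomy j i with hji | rfl | hji
    · obtain ⟨p, hp, hj⟩ := h.exists_snd j hjn
      exact ⟨_, hmem p hp, by grind [shiftInterval, h.fst_le_snd p hp]⟩
    · exact ⟨_, hmem _ (h.lowTop_mem (by omega)), by grind [shiftInterval]⟩
    · obtain ⟨p, hp, hj⟩ := h.exists_snd (j - 1) (by omega)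
      exact ⟨_, hmem p hp, by grind [shiftInterval]⟩

theorem isFishburn_addTop (h : IsFishburn n s) (hin : i ≤ n) :
    IsFishburn (if i < n ∧ i ≤ lowTop s then n else n + 1) (addTop i s) := by
  split_ifs with hi
  · exact h.isFishburn_addTop_of_le hi
  · exact h.isFishburn_addTop_of_not_le hin hi

theorem lowTop_addTop (h : IsFishburn n s) (hin : i ≤ n) : lowTop (addTop i s) = i := by
  by_cases hi : i < n ∧ i ≤ lowTop s
  · have h' := h.isFishburn_addTop_of_le hi
    rw [h.addTop_of_le hi] at h' ⊢
    exact h'.lowTop_eq (Multiset.mem_cons_self _ _)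
      (Multiset.forall_mem_cons.2
        ⟨fun _ => le_rfl, fun p hp hpn => hi.2.trans (h.lowTop_le hp hpn)⟩)
  · have h' := h.isFishburn_addTop_of_not_le hin hi
    rw [h.addTop_of_not_le hi] at h' ⊢
    refine h'.lowTop_eq (Multiset.mem_cons_self _ _) ?_
    rw [Multiset.forall_mem_cons, Multiset.forall_mem_map_iff]
    exact ⟨fun _ => le_rfl, fun p hp => by grind [shiftInterval, h.snd_lt p hp]⟩

theorem dropTop_addTop (h : IsFishburn n s) (hin : i ≤ n) : dropTop (addTop i s) = s := by
  by_cases hi : i < n ∧ i ≤ lowTop s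
  · obtain ⟨p, hp, hpi⟩ := h.exists_fst i hi.1
    rw [dropTop, h.lowTop_addTop hin, (h.isFishburn_addTop_of_le hi).height_eq, h.addTop_of_le hi,
      Multiset.erase_cons_head, if_pos (Multiset.mem_map.2 ⟨p, hp, hpi⟩)]
  · have hne : i ∉ (s.map (shiftInterval n i)).map Prod.fst := by
      simp only [Multiset.mem_map, exists_exists_and_eq_and, not_exists, not_and]
      exact fun p _ => shiftInterval_fst_ne n i p
    rw [dropTop, h.lowTop_addTop hin, (h.isFishburn_addTop_of_not_le hin hi).height_eq,
      h.addTop_of_not_le hi, Nat.add_sub_cancel, Multiset.erase_cons_head, if_neg hne,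
      Multiset.map_map]
    exact (Multiset.map_congr rfl fun p hp =>
      unshiftInterval_shiftInterval (h.fst_le_snd p hp) (h.snd_lt p hp) i).trans
        (Multiset.map_id' s)

theorem dropTop_of_mem (h : IsFishburn n s)
    (hex : lowTop s ∈ (s.erase (lowTop s, n - 1)).map Prod.fst) :
    dropTop s = s.erase (lowTop s, n - 1) := by
  rw [dropTop, h.height_eq, if_pos hex]

theorem dropTop_of_notMem (h : IsFishburn n s)
    (hex : lowTop s ∉ (s.erase (lowTop s, n - 1)).map Prod.fst) :
    dropTop s = (s.erase (lowTop s, n - 1)).map (unshiftInterval (n - 1) (lowTop s)) := by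
  rw [dropTop, h.height_eq, if_neg hex]

theorem isFishburn_dropTop_of_mem (h : IsFishburn n s)
    (hex : lowTop s ∈ (s.erase (lowTop s, n - 1)).map Prod.fst) : IsFishburn n (dropTop s) := by
  rw [h.dropTop_of_mem hex]
  have hsub : s.erase (lowTop s, n - 1) ⊆ s := Multiset.erase_subset _ _
  have hmem : ∀ p ∈ s, p ≠ (lowTop s, n - 1) → p ∈ s.erase (lowTop s, n - 1) :=
    fun p hp hne => (Multiset.mem_erase_of_ne hne).2 hp
  obtain ⟨q, hq, hqi⟩ := Multiset.mem_map.1 hex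
  refine ⟨fun p hp => h.fst_le_snd p (hsub hp), fun p hp => h.snd_lt p (hsub hp),
    fun j hj => ?_, fun j hj => ?_⟩
  · obtain ⟨p, hp, hpj⟩ := h.exists_fst j hj
    by_cases hpm : p = (lowTop s, n - 1)
    · exact ⟨q, hq, by rw [hqi, ← hpj, hpm]⟩
    · exact ⟨p, hmem p hp hpm, hpj⟩
  · rcases (Nat.le_sub_one_of_lt hj).eq_or_lt with rfl | hjn
    · -- An interval starting at the last index also ends there.
      obtain ⟨p, hp, hpn⟩ := h.exists_fst (n - 1) hj
      have hle := h.fst_le_snd p hp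
      have hlt := h.snd_lt p hp
      by_cases hpm : p = (lowTop s, n - 1)
      · have := h.fst_le_snd q (hsub hq)
        have := h.snd_lt q (hsub hq)
        exact ⟨q, hq, by grind⟩
      · exact ⟨p, hmem p hp hpm, by omega⟩
    · obtain ⟨p, hp, hpj⟩ := h.exists_snd j hj
      exact ⟨p, hmem p hp fun hpm => by grind, hpj⟩

theorem isFishburn_dropTop_of_notMem (h : IsFishburn n s)
    (hex : lowTop s ∉ (s.erase (lowTop s, n - 1)).map Prod.fst) :
    IsFishburn (n - 1) (dropTop s) := by
  rw [h.dropTop_of_notMem hex]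
  have hsub : s.erase (lowTop s, n - 1) ⊆ s := Multiset.erase_subset _ _
  have hne : ∀ p ∈ s.erase (lowTop s, n - 1), p.1 ≠ lowTop s :=
    fun p hp hpi => hex (Multiset.mem_map.2 ⟨p, hp, hpi⟩)
  have hmem : ∀ p ∈ s, p ≠ (lowTop s, n - 1) → p.1 ≠ lowTop s ∧
      unshiftInterval (n - 1) (lowTop s) p ∈
        (s.erase (lowTop s, n - 1)).map (unshiftInterval (n - 1) (lowTop s)) := fun p hp hpm =>
    have hp := (Multiset.mem_erase_of_ne hpm).2 hp
    ⟨hne p hp, Multiset.mem_map_of_mem _ hp⟩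
  have hval : ∀ p ∈ s.erase (lowTop s, n - 1),
      p.1 ≤ p.2 ∧ p.1 ≠ lowTop s ∧ p.2 < n ∧ lowTop s < n ∧ (p.2 + 1 = n → lowTop s ≤ p.1) :=
    fun p hp => ⟨h.fst_le_snd p (hsub hp), hne p hp, h.snd_lt p (hsub hp),
      h.lowTop_lt (pos_of_gt (h.snd_lt p (hsub hp))), h.lowTop_le (hsub hp)⟩
  refine ⟨?_, ?_, fun j hj => ?_, fun j hj => ?_⟩
  · rw [Multiset.forall_mem_map_iff]
    intro p hp
    clear hmem hne
    grind [unshiftInterval]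
  · rw [Multiset.forall_mem_map_iff]
    intro p hp
    clear hmem hne
    grind [unshiftInterval]
  · obtain ⟨p, hp, hpj⟩ := h.exists_fst (if j < lowTop s then j else j + 1) (by grind)
    obtain ⟨-, hp'⟩ := hmem p hp (by grind)
    exact ⟨_, hp', by grind [unshiftInterval]⟩
  · -- The intervals that ended at the deleted index now end at the last one.
    obtain ⟨p, hp, hpj⟩ := h.exists_snd
      (if j < lowTop s then j else if j + 2 = n then lowTop s else j + 1) (by grind)
    obtain ⟨hpi, hp'⟩ := hmem p hp (by grind)
    exact ⟨_, hp', by grind [unshiftInterval, h.fst_le_snd p hp]⟩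

theorem isFishburn_dropTop (h : IsFishburn n s) : ∃ k, IsFishburn k (dropTop s) ∧ n ≤ k + 1 := by
  by_cases hex : lowTop s ∈ (s.erase (lowTop s, n - 1)).map Prod.fst
  · exact ⟨n, h.isFishburn_dropTop_of_mem hex, by omega⟩
  · exact ⟨n - 1, h.isFishburn_dropTop_of_notMem hex, by omega⟩

theorem addTop_dropTop (h : IsFishburn n s) (hn : 0 < n) : addTop (lowTop s) (dropTop s) = s := by
  have hcons := Multiset.cons_erase (h.lowTop_mem hn)
  have hsub : s.erase (lowTop s, n - 1) ⊆ s := Multiset.erase_subset _ _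
  by_cases hex : lowTop s ∈ (s.erase (lowTop s, n - 1)).map Prod.fst
  · have h' := h.isFishburn_dropTop_of_mem hex
    have hle : lowTop s ≤ lowTop (dropTop s) := by
      refine h.lowTop_le (p := (lowTop (dropTop s), n - 1)) (hsub ?_) (by grind)
      simpa only [h.dropTop_of_mem hex] using h'.lowTop_mem hn
    rw [h'.addTop_of_le ⟨h.lowTop_lt hn, hle⟩, h.dropTop_of_mem hex, hcons]
  · have h' := h.isFishburn_dropTop_of_notMem hex
    have hlow : ¬(lowTop s < n - 1 ∧ lowTop s ≤ lowTop (dropTop s)) := by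
      rintro ⟨hlt, hle⟩
      obtain ⟨p, hp, hpi⟩ := h.exists_snd (lowTop s) (by omega)
      have hp : p ∈ s.erase (lowTop s, n - 1) := (Multiset.mem_erase_of_ne (by grind)).2 hp
      have hne : p.1 ≠ lowTop s := fun hpi => hex (Multiset.mem_map.2 ⟨p, hp, hpi⟩)
      have hle' := h'.lowTop_le (p := unshiftInterval (n - 1) (lowTop s) p)
        (by rw [h.dropTop_of_notMem hex]; exact Multiset.mem_map_of_mem _ hp)
      grind [unshiftInterval, h.fst_le_snd p (hsub hp)]
    rw [h'.addTop_of_not_le hlow, h.dropTop_of_notMem hex, Multiset.map_map,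
      Multiset.map_congr rfl fun p hp => ?_, Multiset.map_id', hcons]
    exact shiftInterval_unshiftInterval (h.fst_le_snd p (hsub hp))
      (fun hpi => hex (Multiset.mem_map.2 ⟨p, hp, hpi⟩))
      (Nat.le_sub_one_of_lt (h.snd_lt p (hsub hp)))
      fun hpn => h.lowTop_le (hsub hp) (by omega)

theorem lowTop_le_height_dropTop (h : IsFishburn n s) (hn : 0 < n) :
    lowTop s ≤ height (dropTop s) := by
  obtain ⟨k, hk, hnk⟩ := h.isFishburn_dropTop
  rw [hk.height_eq]
  exact Nat.lt_succ_iff.1 ((h.lowTop_lt hn).trans_le hnk)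

theorem countP_addTop (h : IsFishburn n s) (i : ℕ) :
    (addTop i s).countP (fun p => p.1 = 0) =
      s.countP (fun p => p.1 = 0) + if i = 0 then 1 else 0 := by
  by_cases hi : i < n ∧ i ≤ lowTop s
  · rw [h.addTop_of_le hi, Multiset.countP_cons]
  · rw [h.addTop_of_not_le hi, Multiset.countP_cons, Multiset.countP_map,
      ← Multiset.countP_eq_card_filter]
    congr 1
    refine Multiset.countP_congr rfl fun p hp => ?_
    have := h.snd_lt p hp
    grind [shiftInterval]

end IsFishburn

theorem card_addTop (i : ℕ) (s : Multiset (ℕ × ℕ)) :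
    Multiset.card (addTop i s) = Multiset.card s + 1 := by
  unfold addTop
  split_ifs <;> simp

/-! ### Interval representations of `(2+2)`-free posets -/

/-- The largest index `j` such that `x` does not belong to the `j`-th strict principal down-set
`D_j`. -/
def lastAvoid {P : Type*} [PartialOrder P] (x : P) : ℕ :=
  {D ∈ downSets P | x ∉ D}.ncard - 1

/-- `f` represents `P` as an interval order by intervals in `{0, …, n - 1}`, where every index is a
left end point and a right end point. -/
structure IsRep {P : Type*} [PartialOrder P] [Fintype P] (n : ℕ) (f : P → ℕ × ℕ) : Prop where
  lt_iff : ∀ x y, x < y ↔ (f x).2 < (f y).1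
  isFishburn : IsFishburn n ((Finset.univ : Finset P).val.map f)

namespace IsRep

variable {P : Type*} [PartialOrder P] [Fintype P] {n : ℕ} {f : P → ℕ × ℕ}

theorem left_le_right (h : IsRep n f) (x : P) : (f x).1 ≤ (f x).2 :=
  h.isFishburn.fst_le_snd _ (Multiset.mem_map_of_mem f (Finset.mem_univ_val x))

theorem right_lt (h : IsRep n f) (x : P) : (f x).2 < n :=
  h.isFishburn.snd_lt _ (Multiset.mem_map_of_mem f (Finset.mem_univ_val x))

theorem left_lt (h : IsRep n f) (x : P) : (f x).1 < n :=
  (h.left_le_right x).trans_lt (h.right_lt x)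

theorem exists_left (h : IsRep n f) {j : ℕ} (hj : j < n) : ∃ x, (f x).1 = j := by
  simpa using h.isFishburn.exists_fst j hj

theorem exists_right (h : IsRep n f) {j : ℕ} (hj : j < n) : ∃ x, (f x).2 = j := by
  simpa using h.isFishburn.exists_snd j hj

theorem isMax_iff (h : IsRep n f) (x : P) : IsMax x ↔ (f x).2 + 1 = n := by
  simp only [isMax_iff_forall_not_lt, h.lt_iff]
  have hx := h.right_lt x
  refine ⟨fun hmax => ?_, fun hxn y => ?_⟩
  · obtain ⟨y, hy⟩ := h.exists_left (j := n - 1) (by omega)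
    have := hmax y
    omega
  · have := h.left_lt y
    omega

theorem isMin_iff (h : IsRep n f) (x : P) : IsMin x ↔ (f x).1 = 0 := by
  simp only [isMin_iff_forall_not_lt, h.lt_iff]
  refine ⟨fun hmin => ?_, fun hx y => ?_⟩
  · obtain ⟨y, hy⟩ := h.exists_right (j := 0) (pos_of_gt (h.left_lt x))
    have := hmin y
    omega
  · omega

theorem isFree (h : IsRep n f) : IsFree P := by
  refine ⟨fun g => ?_⟩
  have h1 := (h.lt_iff _ _).1 (g.lt_iff_lt.2 (Sum.inl_lt_inl_iff.2 (show (0 : Fin 2) < 1 by simp)))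
  have h2 := (h.lt_iff _ _).1 (g.lt_iff_lt.2 (Sum.inr_lt_inr_iff.2 (show (0 : Fin 2) < 1 by simp)))
  have h3 := mt (h.lt_iff _ _).2 (mt g.lt_iff_lt.1
    (Sum.not_inl_lt_inr (a := (1 : Fin 2)) (b := (0 : Fin 2))))
  have h4 := mt (h.lt_iff _ _).2 (mt g.lt_iff_lt.1
    (Sum.not_inr_lt_inl (a := (1 : Fin 2)) (b := (0 : Fin 2))))
  omega

theorem Iio_eq (h : IsRep n f) (x : P) : Set.Iio x = {y | (f y).2 < (f x).1} :=
  Set.ext fun y => h.lt_iff y x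

theorem subset_iff (h : IsRep n f) {i j : ℕ} (hi : i < n) :
    {y | (f y).2 < i} ⊆ {y | (f y).2 < j} ↔ i ≤ j := by
  refine ⟨fun hs => not_lt.1 fun hji => ?_, fun hij y hy => lt_of_lt_of_le hy hij⟩
  obtain ⟨y, rfl⟩ := h.exists_right (hji.trans hi)
  exact lt_irrefl (f y).2 (hs hji)

theorem downSets_eq (h : IsRep n f) : downSets P = (fun j => {y | (f y).2 < j}) '' Set.Iio n := by
  ext D
  constructor
  · rintro ⟨x, rfl⟩
    exact ⟨(f x).1, h.left_lt x, (h.Iio_eq x).symm⟩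
  · rintro ⟨j, hj, rfl⟩
    obtain ⟨x, rfl⟩ := h.exists_left hj
    exact ⟨x, h.Iio_eq x⟩

theorem injOn (h : IsRep n f) : Set.InjOn (fun j => {y | (f y).2 < j}) (Set.Iio n) :=
  fun _ hi _ hj hij => le_antisymm ((h.subset_iff hi).1 hij.le) ((h.subset_iff hj).1 hij.ge)

theorem ncard_sep (h : IsRep n f) (p : Set P → Prop) :
    {D ∈ downSets P | p D}.ncard = {j | j < n ∧ p {y | (f y).2 < j}}.ncard := by
  rw [← (h.injOn.mono (s₁ := {j | j < n ∧ p {y | (f y).2 < j}}) fun j hj => hj.1).ncard_image,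
    h.downSets_eq]
  congr 1
  ext D
  constructor
  · rintro ⟨⟨j, hj, rfl⟩, hD⟩
    exact ⟨j, ⟨hj, hD⟩, rfl⟩
  · rintro ⟨j, ⟨hj, hD⟩, rfl⟩
    exact ⟨⟨j, hj, rfl⟩, hD⟩

theorem level_eq (h : IsRep n f) (x : P) : level x = (f x).1 := by
  have hlevels : {j | j < n ∧ {y | (f y).2 < j} ⊂ Set.Iio x} = Set.Iio (f x).1 := by
    ext j
    have hx := h.left_lt x
    rw [Set.mem_ofPred_eq, Set.mem_Iio, h.Iio_eq, Set.ssubset_def, h.subset_iff hx, not_le]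
    exact ⟨fun hj => hj.2.2, fun hj => ⟨hj.trans hx, (h.subset_iff (hj.trans hx)).2 hj.le, hj⟩⟩
  rw [level, h.ncard_sep, hlevels, Set.ncard_Iio_nat]

theorem lastAvoid_eq (h : IsRep n f) (x : P) : lastAvoid x = (f x).2 := by
  have havoid : {j | j < n ∧ x ∉ {y | (f y).2 < j}} = Set.Iio ((f x).2 + 1) := by
    ext j
    have := h.right_lt x
    simp only [Set.mem_ofPred_eq, Set.mem_Iio]
    omega
  rw [lastAvoid, h.ncard_sep, havoid, Set.ncard_Iio_nat, Nat.add_sub_cancel]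

theorem mem_downSet (h : IsRep n f) (j : ℕ) (y : P) : y ∈ downSet P j ↔ j < n ∧ (f y).2 < j := by
  simp only [downSet, Set.mem_ofPred_eq, h.level_eq, h.lt_iff]
  constructor
  · rintro ⟨x, rfl, hy⟩
    exact ⟨h.left_lt x, hy⟩
  · rintro ⟨hj, hy⟩
    obtain ⟨x, rfl⟩ := h.exists_left hj
    exact ⟨x, rfl, hy⟩

theorem mem_uncovered (h : IsRep n f) (m y : P) :
    y ∈ uncovered m ↔
      (∀ w, (f w).1 = (f m).1 → w = m) ∧ (f m).1 + 1 < n ∧ (f y).2 = (f m).1 := by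
  simp only [uncovered, Set.mem_ofPred_eq, Set.mem_sdiff, h.mem_downSet, h.level_eq]
  have := h.left_lt m
  refine and_congr_right fun _ => ?_
  omega

end IsRep

theorem bijOn_ncard_lt_of_isChain {α : Type*} [PartialOrder α] {S : Set α}
    (hS : IsChain (· ≤ ·) S) (hfin : S.Finite) :
    Set.BijOn (fun a => {b ∈ S | b < a}.ncard) S (Set.Iio S.ncard) := by
  have hmaps : Set.MapsTo (fun a => {b ∈ S | b < a}.ncard) S (Set.Iio S.ncard) := fun a ha =>
    Set.ncard_lt_ncard ⟨fun b hb => hb.1, fun hs => (hs ha).2.false⟩ hfin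
  have hmono : StrictMonoOn (fun a => {b ∈ S | b < a}.ncard) S := fun a ha b _ hab =>
    Set.ncard_lt_ncard ⟨fun c hc => ⟨hc.1, hc.2.trans hab⟩, fun hs => (hs ⟨ha, hab⟩).2.false⟩
      (hfin.subset fun c hc => hc.1)
  have hinj : Set.InjOn (fun a => {b ∈ S | b < a}.ncard) S := fun a ha b hb heq => by
    by_contra hne
    rcases hS ha hb hne with hab | hba
    · exact (hmono ha hb (hab.lt_of_ne hne)).ne heq
    · exact (hmono hb ha (hba.lt_of_ne' hne)).ne' heq
  refine ⟨hmaps, hinj, (Set.eq_of_subset_of_ncard_le hmaps.image_subset ?_).ge⟩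
  rw [hinj.ncard_image, Set.ncard_Iio_nat]

namespace IsFree

variable {P : Type*} [PartialOrder P]

theorem subset_or_subset (h : IsFree P) (x y : P) :
    Set.Iio x ⊆ Set.Iio y ∨ Set.Iio y ⊆ Set.Iio x := by
  by_contra! hxy
  obtain ⟨⟨a, hax, hay⟩, ⟨b, hby, hbx⟩⟩ := hxy.imp Set.not_subset.1 Set.not_subset.1
  simp only [Set.mem_Iio] at hax hay hby hbx
  have h1 : ¬ a ≤ b := fun h => hay (h.trans_lt hby)
  have h2 : ¬ a ≤ y := fun h => h.lt_or_eq.elim hay fun h => hbx (hby.trans (h ▸ hax))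
  have h3 : ¬ x ≤ b := fun h => hay (hax.trans (h.trans_lt hby))
  have h4 : ¬ x ≤ y := fun h => hay (hax.trans_le h)
  have h5 : ¬ b ≤ a := fun h => hbx (h.trans_lt hax)
  have h6 : ¬ b ≤ x := fun h => h.lt_or_eq.elim hbx fun h => hay (hax.trans (h ▸ hby))
  have h7 : ¬ y ≤ a := fun h => hbx (hby.trans (h.trans_lt hax))
  have h8 : ¬ y ≤ x := fun h => hbx (hby.trans_le h)
  refine h.false (OrderEmbedding.ofMapLEIff (Sum.elim ![a, x] ![b, y]) ?_)
  rintro (i | i) (j | j) <;> fin_cases i <;> fin_cases j <;>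
    simp [h1, h2, h3, h4, h5, h6, h7, h8, hax.le, hby.le, hax.not_ge, hby.not_ge]

theorem isChain_downSets (h : IsFree P) : IsChain (· ≤ ·) (downSets P) := by
  rintro _ ⟨x, rfl⟩ _ ⟨y, rfl⟩ -
  exact h.subset_or_subset x y

theorem exists_level_eq [Finite P] (h : IsFree P) {j : ℕ} (hj : j < (downSets P).ncard) :
    ∃ x : P, level x = j := by
  obtain ⟨_, ⟨x, rfl⟩, hx⟩ :=
    (bijOn_ncard_lt_of_isChain h.isChain_downSets (Set.toFinite _)).surjOn hj
  exact ⟨x, hx⟩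

theorem lt_iff [Finite P] (h : IsFree P) (x y : P) : x < y ↔ lastAvoid x < level y := by
  have hpos : 0 < {D ∈ downSets P | x ∉ D}.ncard :=
    (Set.ncard_pos (Set.toFinite _)).2 ⟨Set.Iio x, ⟨x, rfl⟩, lt_irrefl x⟩
  unfold lastAvoid level
  constructor
  · intro hxy
    have : {D ∈ downSets P | x ∉ D}.ncard ≤ {D ∈ downSets P | D ⊂ Set.Iio y}.ncard := by
      refine Set.ncard_le_ncard ?_ (Set.toFinite _)
      rintro _ ⟨⟨w, rfl⟩, hw⟩
      have hyw : ¬ Set.Iio y ⊆ Set.Iio w := fun hs => hw (hs hxy)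
      exact ⟨⟨w, rfl⟩, (h.subset_or_subset w y).resolve_right hyw, hyw⟩
    omega
  · intro hlt
    by_contra hxy
    have : {D ∈ downSets P | D ⊂ Set.Iio y}.ncard < {D ∈ downSets P | x ∉ D}.ncard := by
      refine Set.ncard_lt_ncard ⟨fun D hD => ⟨hD.1, fun hx => hxy (hD.2.1 hx)⟩, fun hs => ?_⟩
        (Set.toFinite _)
      exact (hs (a := Set.Iio y) ⟨⟨y, rfl⟩, hxy⟩).2.2 subset_rfl
    omega

theorem exists_lastAvoid_eq [Finite P] (h : IsFree P) {j : ℕ} (hj : j < (downSets P).ncard) :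
    ∃ x : P, lastAvoid x = j := by
  obtain ⟨y, hy⟩ := h.exists_level_eq hj
  have hle : ∀ x, ¬ x < y → j ≤ lastAvoid x := fun x hx => by
    rwa [h.lt_iff, hy, not_lt] at hx
  by_cases hjn : j + 1 < (downSets P).ncard
  · obtain ⟨z, hz⟩ := h.exists_level_eq hjn
    have hsub : ¬ Set.Iio z ⊆ Set.Iio y := fun hs => by
      have : level z ≤ level y :=
        Set.ncard_le_ncard (fun D hD => ⟨hD.1, hD.2.trans_subset hs⟩) (Set.toFinite _)
      omega
    obtain ⟨x, hxz, hxy⟩ := Set.not_subset.1 hsub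
    have := (h.lt_iff x z).1 hxz
    exact ⟨x, le_antisymm (by omega) (hle x hxy)⟩
  · have hcard : {D ∈ downSets P | y ∉ D}.ncard ≤ (downSets P).ncard :=
      Set.ncard_le_ncard (fun D hD => hD.1) (Set.toFinite _)
    exact ⟨y, le_antisymm (by unfold lastAvoid; omega) (hle y (lt_irrefl y))⟩

theorem isRep [Fintype P] (h : IsFree P) :
    IsRep (downSets P).ncard fun x : P => (level x, lastAvoid x) where
  lt_iff := h.lt_iff
  isFishburn := by
    constructor <;> simp only [Multiset.mem_map, Finset.mem_val, Finset.mem_univ, true_and,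
      forall_exists_index, forall_apply_eq_imp_iff, exists_exists_eq_and]
    · exact fun x => not_lt.1 fun hx => lt_irrefl x ((h.lt_iff x x).2 hx)
    · intro x
      have hpos : 0 < (downSets P).ncard := (Set.ncard_pos (Set.toFinite _)).2 ⟨_, x, rfl⟩
      have hle : {D ∈ downSets P | x ∉ D}.ncard ≤ (downSets P).ncard :=
        Set.ncard_le_ncard (fun D hD => hD.1) (Set.toFinite _)
      unfold lastAvoid
      omega
    · exact fun j => h.exists_level_eq
    · exact fun j => h.exists_lastAvoid_eq

end IsFree

/-! ### Posets and Fishburn multisets -/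

/-- The multiset of the intervals of the elements of `P` in its canonical representation. -/
def code (P : Type*) [PartialOrder P] [Fintype P] : Multiset (ℕ × ℕ) :=
  (Finset.univ : Finset P).val.map fun x => (level x, lastAvoid x)

theorem IsRep.code_eq {P : Type*} [PartialOrder P] [Fintype P] {n : ℕ} {f : P → ℕ × ℕ}
    (h : IsRep n f) : code P = (Finset.univ : Finset P).val.map f := by
  simp only [code, h.level_eq, h.lastAvoid_eq, Prod.mk.eta]

theorem IsRep.isFishburn_code {P : Type*} [PartialOrder P] [Fintype P] {n : ℕ} {f : P → ℕ × ℕ}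
    (h : IsRep n f) : IsFishburn n (code P) := by
  rw [h.code_eq]
  exact h.isFishburn

theorem card_code {P : Type*} [PartialOrder P] [Fintype P] :
    Multiset.card (code P) = Nat.card P := by
  simp [code]

theorem exists_equiv_of_map_univ_eq {α β γ : Type*} [Fintype α] [Fintype β] {f : α → γ}
    {g : β → γ} (h : (Finset.univ : Finset α).val.map f = (Finset.univ : Finset β).val.map g) :
    ∃ e : α ≃ β, ∀ x, g (e x) = f x := by
  classical
  have hcard : ∀ c, Fintype.card {a // f a = c} = Fintype.card {b // g b = c} := fun c => by
    have := congrArg (Multiset.count c) h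
    rw [Multiset.count_map, Multiset.count_map] at this
    rw [Fintype.card_subtype, Fintype.card_subtype]
    simpa [Finset.card, eq_comm] using this
  exact ⟨Equiv.ofFiberEquiv fun c => Fintype.equivOfCardEq (hcard c),
    fun x => Equiv.ofFiberEquiv_map _ x⟩

namespace IsFree

variable {P Q : Type*} [PartialOrder P] [PartialOrder Q] [Fintype P] [Fintype Q]

theorem isFishburn_code (h : IsFree P) : IsFishburn (downSets P).ncard (code P) :=
  h.isRep.isFishburn_code

theorem levels_eq (h : IsFree P) : levels P = height (code P) - 1 := by
  rw [h.isFishburn_code.height_eq, levels]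

theorem minmax_eq (h : IsFree P) : minmax P = lowTop (code P) := by
  rw [lowTop, minmax, h.isFishburn_code.height_eq]
  congr 1
  ext a
  simp only [code, Set.mem_image, Set.mem_ofPred_eq, Multiset.mem_map, Finset.mem_val,
    Finset.mem_univ, true_and, Prod.mk.injEq]
  refine exists_congr fun x => ?_
  have := h.isRep.right_lt x
  rw [h.isRep.isMax_iff, and_comm]
  exact and_congr_right fun _ => by omega

theorem minCount_eq (h : IsFree P) : minCount P = (code P).countP fun p => p.1 = 0 := by
  classical
  simp only [minCount, code, Multiset.countP_map, Set.ncard_eq_toFinset_card', h.isRep.isMin_iff,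
    Set.toFinset_ofPred]
  rfl

theorem nonempty_orderIso_of_code_eq (hP : IsFree P) (hQ : IsFree Q) (h : code P = code Q) :
    Nonempty (P ≃o Q) := by
  obtain ⟨e, he⟩ := exists_equiv_of_map_univ_eq h
  simp only [Prod.mk.injEq] at he
  have hlt : ∀ x y, e x < e y ↔ x < y := fun x y => by
    rw [hP.lt_iff, hQ.lt_iff, (he x).2, (he y).1]
  refine ⟨⟨e, fun {x y} => ?_⟩⟩
  rw [le_iff_lt_or_eq, le_iff_lt_or_eq, hlt, e.injective.eq_iff]

theorem code_congr (h : IsFree P) (e : P ≃o Q) : code P = code Q := by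
  have hmap : (Finset.univ : Finset Q).val.map (fun y => (level (e.symm y), lastAvoid (e.symm y))) =
      code P := by
    rw [code, ← Multiset.map_univ_val_equiv e.symm.toEquiv, Multiset.map_map]
    rfl
  have hrep : IsRep _ fun y : Q => (level (e.symm y), lastAvoid (e.symm y)) :=
    ⟨fun x y => by rw [← h.lt_iff, e.symm.lt_iff_lt], hmap ▸ h.isFishburn_code⟩
  rw [hrep.code_eq, hmap]

end IsFree

theorem IsFishburn.exists_poset {n : ℕ} {s : Multiset (ℕ × ℕ)} (h : IsFishburn n s) :
    ∃ P : FinPartOrd.{0}, IsFree P ∧ code P = s := by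
  have hle : ∀ a : s.ToType, a.1.1 ≤ a.1.2 := fun a => h.fst_le_snd _ Multiset.coe_mem
  have hstrict : IsStrictOrder s.ToType fun a b => a.1.2 < b.1.1 :=
    { irrefl := fun a => (hle a).not_gt
      trans := fun a b c hab hbc => hab.trans ((hle b).trans_lt hbc) }
  let _ : PartialOrder s.ToType := partialOrderOfSO fun a b => a.1.2 < b.1.1
  have hrep : IsRep n fun a : s.ToType => a.1 :=
    ⟨fun a b => Iff.rfl, by rwa [s.map_univ_coe]⟩
  exact ⟨FinPartOrd.of s.ToType, hrep.isFree, hrep.code_eq.trans s.map_univ_coe⟩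

/-! ### The decomposition in terms of intervals -/

theorem exists_removal (P : FinPartOrd.{0}) [Nonempty P] : ∃ Q, Removal P Q := by
  classical
  obtain ⟨m, hm, hlevel⟩ : minmax P ∈ level '' {x : P | IsMax x} := by
    obtain ⟨x, hx⟩ := (Set.toFinite (Set.univ : Set P)).exists_maximal Set.univ_nonempty
    exact Nat.sInf_mem ⟨_, x, fun y hy => hx.2 trivial hy, rfl⟩
  have hstrict : IsStrictOrder {p : P // p ≠ m} fun a b => (a : P) < b ∧ (a : P) ∉ uncovered m :=
    { irrefl := fun a ha => ha.1.false
      trans := fun a b c hab hbc => ⟨hab.1.trans hbc.1, hab.2⟩ }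
  exact ⟨@FinPartOrd.of {p : P // p ≠ m}
    (partialOrderOfSO fun a b => (a : P) < b ∧ (a : P) ∉ uncovered m) _,
    m, hm, hlevel, Equiv.refl _, fun a b => Iff.rfl⟩

theorem map_univ_equiv_ne {α β γ : Type*} [Fintype α] [Fintype β] [DecidableEq γ] {m : α}
    (e : β ≃ {a // a ≠ m}) (f : α → γ) :
    (Finset.univ : Finset β).val.map (fun b => f (e b)) =
      ((Finset.univ : Finset α).val.map f).erase (f m) := by
  classical
  have himage : (Finset.univ : Finset β).val.map (fun b => (e b : α)) =
      Finset.univ.val.erase m := by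
    rw [← Finset.erase_val, ← Finset.filter_ne' Finset.univ m, ← Finset.subtype_map,
      Finset.map_val, Finset.subtype_univ]
    rw [← Multiset.map_univ_val_equiv e, Multiset.map_map]
    rfl
  rw [← Multiset.cons_erase (Finset.mem_univ_val m), Multiset.map_cons, Multiset.erase_cons_head,
    ← himage, Multiset.map_map]
  rfl

section Removal

variable {P Q : Type*} [PartialOrder P] [PartialOrder Q] [Fintype P] [Fintype Q]
  {n : ℕ} {f : P → ℕ × ℕ} {m : P}

theorem IsRep.removal_of_mem (h : IsRep n f)
    (hm : f m = (lowTop (code P), n - 1)) (e : Q ≃ {p : P // p ≠ m})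
    (he : ∀ a b, a < b ↔ (e a : P) < (e b : P) ∧ (e a : P) ∉ uncovered m)
    (hex : lowTop (code P) ∈ ((code P).erase (lowTop (code P), n - 1)).map Prod.fst) :
    IsFree Q ∧ code Q = dropTop (code P) := by
  have hmap := map_univ_equiv_ne e f
  rw [← h.code_eq] at hmap
  obtain ⟨q, hq⟩ : ∃ q, (f (e q)).1 = (f m).1 := by
    rw [← hm, ← hmap] at hex
    simpa [hm] using hex
  have hunc : ∀ y, y ∉ uncovered m := fun y hy =>
    (e q).2 (((h.mem_uncovered m y).1 hy).1 _ hq)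
  have hdrop := h.isFishburn_code.dropTop_of_mem hex
  rw [← hm, ← hmap] at hdrop
  have hrep : IsRep n fun q => f (e q) :=
    ⟨fun a b => by rw [he, h.lt_iff, and_iff_left (hunc _)],
      hdrop ▸ h.isFishburn_code.isFishburn_dropTop_of_mem hex⟩
  exact ⟨hrep.isFree, hrep.code_eq.trans hdrop.symm⟩

theorem IsRep.removal_of_notMem (h : IsRep n f)
    (hm : f m = (lowTop (code P), n - 1)) (e : Q ≃ {p : P // p ≠ m})
    (he : ∀ a b, a < b ↔ (e a : P) < (e b : P) ∧ (e a : P) ∉ uncovered m)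
    (hex : lowTop (code P) ∉ ((code P).erase (lowTop (code P), n - 1)).map Prod.fst) :
    IsFree Q ∧ code Q = dropTop (code P) := by
  have hmap := map_univ_equiv_ne e f
  rw [← h.code_eq] at hmap
  have hne : ∀ q, (f (e q)).1 ≠ (f m).1 := by
    rw [← hm, ← hmap] at hex
    simpa [hm] using hex
  have hdrop := h.isFishburn_code.dropTop_of_notMem hex
  have hfish := h.isFishburn_code.isFishburn_dropTop_of_notMem hex
  have hlow : ∀ q, (f (e q)).2 = n - 1 → (f m).1 ≤ (f (e q)).1 := fun q hq => by
    have := h.right_lt (e q)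
    rw [hm]
    refine h.isFishburn_code.lowTop_le ?_ (by omega)
    rw [h.code_eq]
    exact Multiset.mem_map_of_mem f (Finset.mem_univ_val _)
  have halone : ∀ w, (f w).1 = (f m).1 → w = m := fun w hw => by
    by_contra hwm
    exact hne (e.symm ⟨w, hwm⟩) (by simpa using hw)
  rw [← hm, ← hmap, Multiset.map_map, show lowTop _ = (f m).1 by rw [hm]] at hdrop
  have hrep : IsRep (n - 1) (unshiftInterval (n - 1) (f m).1 ∘ fun q => f (e q)) := by
    refine ⟨fun a b => ?_, hdrop ▸ hfish⟩
    have ha := h.right_lt (e a)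
    have hb := h.left_lt (e b)
    rw [Function.comp_apply, Function.comp_apply, unshiftInterval_lt_iff (h.left_le_right _) (hne a)
      (by omega) (hne b) (by omega) (hlow a), he, h.lt_iff, h.mem_uncovered]
    refine and_congr_right fun hab => not_congr ⟨fun hu => hu.2.2, fun hu => ⟨halone, ?_, hu⟩⟩
    omega
  exact ⟨hrep.isFree, hrep.code_eq.trans hdrop.symm⟩

end Removal

theorem Removal.code_eq {P Q : FinPartOrd.{0}} (hPQ : Removal P Q) (h : IsFree P) :
    IsFree Q ∧ code Q = dropTop (code P) := by
  obtain ⟨m, hmax, hlevel, e, he⟩ := hPQ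
  have hm : (level m, lastAvoid m) = (lowTop (code P), (downSets P).ncard - 1) := by
    have := (h.isRep.isMax_iff m).1 hmax
    rw [hlevel, h.minmax_eq, ← this, Nat.add_sub_cancel]
  by_cases hex : lowTop (code P) ∈
      ((code P).erase (lowTop (code P), (downSets P).ncard - 1)).map Prod.fst
  · exact h.isRep.removal_of_mem hm e he hex
  · exact h.isRep.removal_of_notMem hm e he hex

/-! ### Ascent sequences and posets -/

/-- The largest letter that can be appended to the ascent sequence `w`. It is also the number of
distinct strict principal down-sets of the corresponding poset. -/
def letterBound (w : List ℕ) : ℕ := if w = [] then 0 else 1 + asc w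

theorem asc_cons_cons (a b : ℕ) (l : List ℕ) :
    asc (a :: b :: l) = asc (b :: l) + if a < b then 1 else 0 := by
  simp [asc, List.countP_cons]

theorem asc_concat {w : List ℕ} (hw : w ≠ []) (i : ℕ) :
    asc (w ++ [i]) = asc w + if w.getLastD 0 < i then 1 else 0 := by
  induction w with
  | nil => exact absurd rfl hw
  | cons a l ih =>
    cases l with
    | nil => simp [asc, List.countP_cons]
    | cons b l =>
      have := ih (by simp)
      simp only [List.cons_append] at this ⊢
      rw [asc_cons_cons, asc_cons_cons, this]
      simp only [List.getLastD_cons]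
      ring

theorem letterBound_concat (w : List ℕ) (i : ℕ) : letterBound (w ++ [i]) = 1 + asc (w ++ [i]) :=
  if_neg (by simp)

theorem isAscentSeq_nil : IsAscentSeq [] := fun _ h => absurd h (Nat.not_lt_zero _)

theorem isAscentSeq_concat {w : List ℕ} {i : ℕ} :
    IsAscentSeq (w ++ [i]) ↔ IsAscentSeq w ∧ i ≤ letterBound w := by
  constructor
  · intro h
    refine ⟨fun j hj => ?_, ?_⟩
    · have := h j (by simp only [List.length_append]; omega)
      rwa [List.getElem_append_left hj, List.take_append_of_le_length hj.le] at this
    · simpa [letterBound, List.length_eq_zero_iff] using h w.length (by simp)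
  · rintro ⟨h, hi⟩ j hj
    rcases Nat.lt_or_ge j w.length with hjw | hjw
    · rw [List.getElem_append_left hjw, List.take_append_of_le_length hjw.le]
      exact h j hjw
    · obtain rfl : j = w.length := by
        simp only [List.length_append, List.length_singleton] at hj
        omega
      simpa [letterBound, List.length_eq_zero_iff] using hi

namespace IsAscentSeq

variable {w : List ℕ} {i : ℕ}

theorem asc_concat (h : IsAscentSeq (w ++ [i])) :
    asc (w ++ [i]) = asc w + if w.getLastD 0 < i then 1 else 0 := by
  by_cases hw : w = []
  · subst hw
    obtain rfl : i = 0 := by simpa [letterBound] using (isAscentSeq_concat.1 h).2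
    simp [asc]
  · exact TwoPlusTwo.asc_concat hw i

theorem asc_eq_zero_iff (h : IsAscentSeq w) : asc w = 0 ↔ ∀ a ∈ w, a = 0 := by
  induction w using List.reverseRecOn with
  | nil => simp [asc]
  | append_singleton w i ih =>
    have hlast : (∀ a ∈ w, a = 0) → w.getLastD 0 = 0 := fun hw => by
      rcases w.eq_nil_or_concat' with rfl | ⟨v, b, rfl⟩
      · rfl
      · simpa using hw b (by simp)
    rw [h.asc_concat, Nat.add_eq_zero_iff, ih (isAscentSeq_concat.1 h).1]
    simp only [List.mem_append, List.mem_singleton, or_imp, forall_and, forall_eq]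
    refine and_congr_right fun hw => ?_
    rw [hlast hw]
    simp [Nat.pos_iff_ne_zero]

end IsAscentSeq

/-- The multiset of the intervals of the poset that corresponds to an ascent sequence. -/
def seqCode (w : List ℕ) : Multiset (ℕ × ℕ) := w.foldl (fun s i => addTop i s) 0

theorem seqCode_concat (w : List ℕ) (i : ℕ) : seqCode (w ++ [i]) = addTop i (seqCode w) := by
  simp [seqCode]

theorem card_seqCode (w : List ℕ) : Multiset.card (seqCode w) = w.length := by
  induction w using List.reverseRecOn with
  | nil => rfl
  | append_singleton w i ih => simp [seqCode_concat, card_addTop, ih]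

namespace IsAscentSeq

variable {w : List ℕ} {i : ℕ}

theorem isFishburn_seqCode_and_lowTop (h : IsAscentSeq w) :
    IsFishburn (letterBound w) (seqCode w) ∧ lowTop (seqCode w) = w.getLastD 0 := by
  induction w using List.reverseRecOn with
  | nil => exact ⟨IsFishburn.zero, by simp [seqCode, lowTop]⟩
  | append_singleton w i ih =>
    obtain ⟨hw, hi⟩ := isAscentSeq_concat.1 h
    obtain ⟨hfish, hlow⟩ := ih hw
    rw [seqCode_concat, hfish.lowTop_addTop hi, List.getLastD_concat]
    refine ⟨?_, rfl⟩
    convert hfish.isFishburn_addTop hi using 1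
    rw [letterBound_concat, h.asc_concat, hlow]
    by_cases hnil : w = []
    · simp_all [letterBound, asc]
    · have hbound : letterBound w = 1 + asc w := if_neg hnil
      have := hfish.lowTop_lt (by omega)
      split_ifs <;> omega

theorem isFishburn_seqCode (h : IsAscentSeq w) : IsFishburn (letterBound w) (seqCode w) :=
  h.isFishburn_seqCode_and_lowTop.1

theorem lowTop_seqCode (h : IsAscentSeq w) : lowTop (seqCode w) = w.getLastD 0 :=
  h.isFishburn_seqCode_and_lowTop.2

theorem height_seqCode (h : IsAscentSeq w) : height (seqCode w) = letterBound w :=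
  h.isFishburn_seqCode.height_eq

theorem asc_eq (h : IsAscentSeq w) : asc w = height (seqCode w) - 1 := by
  rw [h.height_seqCode, letterBound]
  split_ifs with hw
  · rw [hw]
    rfl
  · omega

theorem countP_seqCode (h : IsAscentSeq w) :
    (seqCode w).countP (fun p => p.1 = 0) = w.count 0 := by
  induction w using List.reverseRecOn with
  | nil => rfl
  | append_singleton w i ih =>
    have hw := (isAscentSeq_concat.1 h).1
    rw [seqCode_concat, hw.isFishburn_seqCode.countP_addTop, ih hw, List.count_append,
      List.count_singleton]
    simp

theorem dropTop_seqCode_concat (h : IsAscentSeq (w ++ [i])) :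
    dropTop (seqCode (w ++ [i])) = seqCode w := by
  obtain ⟨hw, hi⟩ := isAscentSeq_concat.1 h
  rw [seqCode_concat, hw.isFishburn_seqCode.dropTop_addTop hi]

end IsAscentSeq

theorem injOn_seqCode : Set.InjOn seqCode {w | IsAscentSeq w} := by
  intro w hw v hv heq
  rw [Set.mem_ofPred_eq] at hw hv
  have hlen : w.length = v.length := by rw [← card_seqCode, heq, card_seqCode]
  induction w using List.reverseRecOn generalizing v with
  | nil => exact (List.length_eq_zero_iff.1 hlen.symm).symm
  | append_singleton w i ih =>
    obtain ⟨v, j, rfl⟩ := v.eq_nil_or_concat'.resolve_left (by rintro rfl; simp at hlen)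
    have hlast : i = j := by
      simpa [heq, hv.lowTop_seqCode] using hw.lowTop_seqCode.symm
    have hinit : seqCode w = seqCode v := by
      rw [← hw.dropTop_seqCode_concat, heq, hv.dropTop_seqCode_concat]
    rw [hlast, ih (isAscentSeq_concat.1 hw).1 (isAscentSeq_concat.1 hv).1 hinit
      (by simpa using hlen)]

/-- The `(2+2)`-free poset `P` corresponds to the ascent sequence `w`: its elements can be added
one by one in such a way that the letters of `w` are the levels on which they become the lowest
maximal elements. -/
structure Encodes (w : List ℕ) (P : FinPartOrd.{0}) : Prop where
  isAscentSeq : IsAscentSeq w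
  isFree : IsFree P
  code_eq : code P = seqCode w

theorem IsAscentSeq.exists_encodes {w : List ℕ} (h : IsAscentSeq w) : ∃ P, Encodes w P := by
  obtain ⟨P, hP, hcode⟩ := h.isFishburn_seqCode.exists_poset
  exact ⟨P, h, hP, hcode⟩

theorem IsFree.exists_encodes {P : FinPartOrd.{0}} (h : IsFree P) : ∃ w, Encodes w P := by
  obtain ⟨n, hn⟩ : ∃ n, Multiset.card (code P) = n := ⟨_, rfl⟩
  induction n generalizing P with
  | zero => exact ⟨[], isAscentSeq_nil, h, Multiset.card_eq_zero.1 hn⟩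
  | succ n ih =>
    have : Nonempty P := by
      rw [card_code] at hn
      exact (Nat.card_pos_iff.1 (hn ▸ n.succ_pos)).1
    obtain ⟨Q, hPQ⟩ := exists_removal P
    obtain ⟨hQ, hcode⟩ := hPQ.code_eq h
    have hpos : 0 < (downSets P).ncard := (Set.ncard_pos (Set.toFinite _)).2 (Set.range_nonempty _)
    have hadd := h.isFishburn_code.addTop_dropTop hpos
    rw [← hcode] at hadd
    obtain ⟨w, hw⟩ := ih hQ (by rwa [← hadd, card_addTop, Nat.add_right_cancel_iff] at hn)
    refine ⟨w ++ [lowTop (code P)], isAscentSeq_concat.2 ⟨hw.isAscentSeq, ?_⟩, h, ?_⟩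
    · rw [← hw.isAscentSeq.height_seqCode, ← hw.code_eq, hcode]
      exact h.isFishburn_code.lowTop_le_height_dropTop hpos
    · rw [seqCode_concat, ← hw.code_eq, hadd]

namespace Encodes

variable {w v l : List ℕ} {i : ℕ} {P Q : FinPartOrd.{0}}

theorem nat_card_eq (h : Encodes w P) : Nat.card P = w.length := by
  rw [← card_code, h.code_eq, card_seqCode]

theorem levels_eq (h : Encodes w P) : levels P = asc w := by
  rw [h.isFree.levels_eq, h.code_eq, h.isAscentSeq.asc_eq]

theorem minmax_eq (h : Encodes w P) : minmax P = w.getLastD 0 := by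
  rw [h.isFree.minmax_eq, h.code_eq, h.isAscentSeq.lowTop_seqCode]

theorem minCount_eq (h : Encodes w P) : minCount P = w.count 0 := by
  rw [h.isFree.minCount_eq, h.code_eq, h.isAscentSeq.countP_seqCode]

theorem nonempty_iff (h : Encodes w P) : Nonempty P ↔ w ≠ [] := by
  rw [← Finite.card_pos_iff, h.nat_card_eq, List.length_pos_iff]

theorem eq_of_orderIso (hP : Encodes w P) (hQ : Encodes v Q) (e : P ≃o Q) : w = v :=
  injOn_seqCode hP.isAscentSeq hQ.isAscentSeq
    (by rw [← hP.code_eq, ← hQ.code_eq, hP.isFree.code_congr e])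

theorem nonempty_orderIso (hP : Encodes w P) (hQ : Encodes w Q) : Nonempty (P ≃o Q) :=
  hP.isFree.nonempty_orderIso_of_code_eq hQ.isFree (hP.code_eq.trans hQ.code_eq.symm)

theorem removal (h : Encodes (w ++ [i]) P) (hPQ : Removal P Q) : Encodes w Q := by
  obtain ⟨hQ, hcode⟩ := hPQ.code_eq h.isFree
  rw [h.code_eq, h.isAscentSeq.dropTop_seqCode_concat] at hcode
  exact ⟨(isAscentSeq_concat.1 h.isAscentSeq).1, hQ, hcode⟩

theorem exists_prefix (h : Encodes w P) (hPQ : Relation.ReflTransGen Removal P Q) :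
    ∃ v, v <+: w ∧ Encodes v Q := by
  induction hPQ using Relation.ReflTransGen.head_induction_on generalizing w with
  | refl => exact ⟨w, List.prefix_rfl, h⟩
  | head hPR _ ih =>
    obtain ⟨m, -⟩ := id hPR
    obtain ⟨v, i, rfl⟩ := w.eq_nil_or_concat'.resolve_left (h.nonempty_iff.1 ⟨m⟩)
    obtain ⟨u, hu, huQ⟩ := ih (h.removal hPR)
    exact ⟨u, hu.trans (List.prefix_append _ _), huQ⟩

theorem exists_reflTransGen (h : Encodes (v ++ l) P) :
    ∃ Q, Relation.ReflTransGen Removal P Q ∧ Encodes v Q := by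
  induction l using List.reverseRecOn generalizing P with
  | nil => exact ⟨P, .refl, by rwa [List.append_nil] at h⟩
  | append_singleton l i ih =>
    rw [← List.append_assoc] at h
    have : Nonempty P := h.nonempty_iff.2 (by simp)
    obtain ⟨R, hPR⟩ := exists_removal P
    obtain ⟨Q, hRQ, hQ⟩ := ih (h.removal hPR)
    exact ⟨Q, .head hPR hRQ, hQ⟩

end Encodes

theorem IsFree.isAntichainPoset_iff {P : Type*} [PartialOrder P] [Finite P] (h : IsFree P) :
    IsAntichainPoset P ↔ levels P = 0 := by
  have := Fintype.ofFinite P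
  constructor
  · intro hP
    by_contra hlevels
    have hn : 1 < (downSets P).ncard := by
      unfold levels at hlevels
      omega
    obtain ⟨x, hx⟩ := h.exists_lastAvoid_eq (j := 0) (by omega)
    obtain ⟨y, hy⟩ := h.exists_level_eq hn
    have hxy : x < y := (h.lt_iff x y).2 (by omega)
    exact hP trivial trivial hxy.ne hxy.le
  · intro hlevels x _ y _ hne hxy
    have := (h.lt_iff x y).1 (lt_of_le_of_ne hxy hne)
    have := h.isRep.left_lt y
    unfold levels at hlevels
    omega

theorem Encodes.isAntichainPoset_iff {w : List ℕ} {P : FinPartOrd.{0}} (h : Encodes w P) :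
    IsAntichainPoset P ↔ ∀ a ∈ w, a = 0 := by
  rw [h.isFree.isAntichainPoset_iff, h.levels_eq, h.isAscentSeq.asc_eq_zero_iff]

theorem Encodes.lds_eq {w : List ℕ} {P : FinPartOrd.{0}} (h : Encodes w P) : lds P = run w := by
  rw [lds, run]
  simp only [h.isAntichainPoset_iff]
  split_ifs
  · rfl
  refine IsGreatest.csSup_eq ⟨?_, ?_⟩
  · rw [← List.takeWhile_append_dropWhile (p := (· = 0)) (l := w)] at h
    obtain ⟨Q, hPQ, hQ⟩ := h.exists_reflTransGen
    refine ⟨Q, hPQ, hQ.isAntichainPoset_iff.2 fun a ha => ?_, hQ.nat_card_eq⟩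
    simpa using List.mem_takeWhile_imp ha
  · rintro _ ⟨Q, hPQ, hanti, rfl⟩
    obtain ⟨v, ⟨l, rfl⟩, hQ⟩ := h.exists_prefix hPQ
    rw [hQ.isAntichainPoset_iff] at hanti
    rw [hQ.nat_card_eq, List.takeWhile_append_of_pos fun a ha => by simpa using hanti a ha]
    simp

theorem ascentGF_eq_posetGF : ascentGF = posetGF := by
  funext d
  have hexists : ∀ w, IsAscentSeq w → ∃ P, Encodes w P := fun w hw => hw.exists_encodes
  choose! F hF using hexists
  have hinj : Set.InjOn (fun w => (Quotient.mk isoSetoid (F w) : UnlabeledPoset))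
      {w | IsAscentSeq w} := fun w hw v hv heq =>
    (Quotient.exact heq).elim ((hF w hw).eq_of_orderIso (hF v hv))
  rw [ascentGF, posetGF, Nat.cast_inj, ← (hinj.mono fun w hw => hw.1).ncard_image]
  congr 1
  ext C
  constructor
  · rintro ⟨w, ⟨hw, hstats⟩, rfl⟩
    have h := hF w hw
    exact ⟨F w, ⟨h.isFree, by rwa [h.nat_card_eq, h.levels_eq, h.minmax_eq, h.minCount_eq,
      h.lds_eq]⟩, rfl⟩
  · rintro ⟨P, ⟨hP, hstats⟩, rfl⟩
    obtain ⟨w, h⟩ := hP.exists_encodes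
    rw [h.nat_card_eq, h.levels_eq, h.minmax_eq, h.minCount_eq, h.lds_eq] at hstats
    exact ⟨w, ⟨h.isAscentSeq, hstats⟩,
      Quotient.sound ((hF w h.isAscentSeq).nonempty_orderIso h)⟩

/-! ### The distribution of the last letter -/

/-- The ascent sequences of length `n`. -/
def ascentSeqs : ℕ → Finset (List ℕ)
  | 0 => {[]}
  | n + 1 =>
    (ascentSeqs n).biUnion fun w => (Finset.range (letterBound w + 1)).image fun i => w ++ [i]

theorem mem_ascentSeqs {n : ℕ} {w : List ℕ} :
    w ∈ ascentSeqs n ↔ IsAscentSeq w ∧ w.length = n := by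
  induction n generalizing w with
  | zero =>
    rw [ascentSeqs, Finset.mem_singleton, List.length_eq_zero_iff, iff_and_self]
    rintro rfl
    exact isAscentSeq_nil
  | succ n ih =>
    simp only [ascentSeqs, Finset.mem_biUnion, Finset.mem_image, Finset.mem_range, ih,
      Nat.lt_succ_iff]
    constructor
    · rintro ⟨v, ⟨hv, rfl⟩, i, hi, rfl⟩
      exact ⟨isAscentSeq_concat.2 ⟨hv, hi⟩, by simp⟩
    · rintro ⟨hw, hlen⟩
      obtain ⟨v, i, rfl⟩ := w.eq_nil_or_concat'.resolve_left (by rintro rfl; simp at hlen)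
      obtain ⟨hv, hi⟩ := isAscentSeq_concat.1 hw
      exact ⟨v, ⟨hv, by simpa using hlen⟩, i, hi, rfl⟩

theorem sum_ascentSeqs_succ {M : Type*} [AddCommMonoid M] (F : List ℕ → M) (n : ℕ) :
    ∑ w ∈ ascentSeqs (n + 1), F w =
      ∑ w ∈ ascentSeqs n, ∑ i ∈ Finset.range (letterBound w + 1), F (w ++ [i]) := by
  rw [ascentSeqs, Finset.sum_biUnion]
  · exact Finset.sum_congr rfl fun w _ => Finset.sum_image fun i _ j _ hij => by simpa using hij
  · intro w _ w' _ hne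
    rw [Function.onFun, Finset.disjoint_left]
    rintro _ hv hv'
    obtain ⟨i, -, rfl⟩ := Finset.mem_image.1 hv
    obtain ⟨j, -, hj⟩ := Finset.mem_image.1 hv'
    exact hne (List.append_inj' hj rfl).1.symm

/-- The ascent sequences of length `n` with a non-zero letter. -/
def mixedSeqs (n : ℕ) : Finset (List ℕ) := {w ∈ ascentSeqs n | ∃ a ∈ w, a ≠ 0}

theorem mem_mixedSeqs {n : ℕ} {w : List ℕ} :
    w ∈ mixedSeqs n ↔ (IsAscentSeq w ∧ w.length = n) ∧ ∃ a ∈ w, a ≠ 0 := by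
  rw [mixedSeqs, Finset.mem_filter, mem_ascentSeqs]

theorem isAscentSeq_replicate (n : ℕ) : IsAscentSeq (List.replicate n 0) :=
  fun i h => by simp

theorem asc_replicate (n : ℕ) : asc (List.replicate n 0) = 0 :=
  (isAscentSeq_replicate n).asc_eq_zero_iff.2 fun _ => List.eq_of_mem_replicate

theorem getLastD_replicate (n : ℕ) : (List.replicate n 0).getLastD 0 = 0 := by
  rw [List.getLastD_eq_getLast?, List.getLast?_replicate]
  split_ifs <;> rfl

theorem sum_ascentSeqs {M : Type*} [AddCommMonoid M] (F : List ℕ → M) (n : ℕ) :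
    ∑ w ∈ ascentSeqs n, F w = F (List.replicate n 0) + ∑ w ∈ mixedSeqs n, F w := by
  have hzero : {w ∈ ascentSeqs n | ¬∃ a ∈ w, a ≠ 0} = {List.replicate n 0} := by
    ext w
    rw [Finset.mem_filter, mem_ascentSeqs, Finset.mem_singleton, List.eq_replicate_iff]
    push Not
    refine ⟨fun h => ⟨h.1.2, h.2⟩, fun h => ⟨⟨?_, h.1⟩, h.2⟩⟩
    exact List.eq_replicate_iff.2 h ▸ isAscentSeq_replicate n
  rw [← Finset.sum_filter_not_add_sum_filter _ fun w : List ℕ => ∃ a ∈ w, a ≠ 0, hzero,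
    Finset.sum_singleton, mixedSeqs]

theorem IsAscentSeq.getLastD_lt_letterBound {w : List ℕ} (h : IsAscentSeq w) (hw : w ≠ []) :
    w.getLastD 0 < letterBound w := by
  rw [← h.lowTop_seqCode]
  exact h.isFishburn_seqCode.lowTop_lt (by simp [letterBound, hw])

theorem run_concat {w : List ℕ} (hw : ∃ a ∈ w, a ≠ 0) (i : ℕ) : run (w ++ [i]) = run w := by
  obtain ⟨a, ha, ha0⟩ := hw
  rw [run, run, if_neg fun h => ha0 (h a (by simp [ha])), if_neg fun h => ha0 (h a ha),
    List.takeWhile_append, if_neg]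
  intro hlen
  have hprefix : w.takeWhile (· = 0) <+: w := ⟨_, List.takeWhile_append_dropWhile⟩
  exact ha0 (by simpa using
    List.takeWhile_eq_self_iff.1 (hprefix.eq_of_length hlen) a ha)

theorem run_replicate_concat (n : ℕ) : run (List.replicate n 0 ++ [1]) = n := by
  rw [run, if_neg fun h => absurd (h 1 (by simp)) one_ne_zero,
    List.takeWhile_append_of_pos (by simp)]
  simp

section Weight

variable {R : Type*} [CommRing R] (u v z x : R)

/-- The monomial of a sequence, without the variable that marks its length. -/
def weight (w : List ℕ) : R :=
  u ^ asc w * v ^ w.getLastD 0 * z ^ w.count 0 * x ^ run w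

theorem weight_replicate (n : ℕ) : weight u v z x (List.replicate n 0) = z ^ n := by
  have hrun : run (List.replicate n 0) = 0 := if_pos fun _ => List.eq_of_mem_replicate
  rw [weight, asc_replicate, getLastD_replicate, hrun, List.count_replicate_self]
  ring

theorem weight_replicate_concat {n : ℕ} (hn : n ≠ 0) :
    weight u v z x (List.replicate n 0 ++ [1]) = u * v * (z * x) ^ n := by
  have hcount : (List.replicate n 0 ++ [1]).count 0 = n := by simp
  rw [weight, asc_concat (by simpa), asc_replicate, getLastD_replicate, List.getLastD_concat,
    run_replicate_concat, hcount, if_pos one_pos]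
  ring

/-- The sum of the monomials of the ascent sequences of length `n` with a non-zero letter. -/
def mixedSum (n : ℕ) : R := ∑ w ∈ mixedSeqs n, weight u v z x w

/-- The part of `mixedSum u v z x (n + 1)` that comes from appending a letter to a sequence which
already has a non-zero letter. -/
def extensionSum (n : ℕ) : R :=
  ∑ w ∈ mixedSeqs n, ∑ i ∈ Finset.range (letterBound w + 1), weight u v z x (w ++ [i])

theorem mixedSum_zero : mixedSum u v z x 0 = 0 := by
  simp [mixedSum, mixedSeqs, ascentSeqs, Finset.filter_singleton]

theorem mixedSum_one : mixedSum u v z x 1 = 0 := by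
  simp [mixedSum, mixedSeqs, ascentSeqs, letterBound, Finset.filter_singleton]

theorem extensionSum_zero : extensionSum u v z x 0 = 0 := by
  simp [extensionSum, mixedSeqs, ascentSeqs, Finset.filter_singleton]

theorem mixedSum_succ {n : ℕ} (hn : n ≠ 0) :
    mixedSum u v z x (n + 1) = u * v * (z * x) ^ n + extensionSum u v z x n := by
  have hbound : letterBound (List.replicate n 0) = 1 := by
    simp [letterBound, hn, asc_replicate]
  rw [mixedSum, mixedSeqs, Finset.sum_filter, sum_ascentSeqs_succ, sum_ascentSeqs, hbound]
  congr 1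
  · rw [← weight_replicate_concat u v z x hn]
    simp [Finset.sum_range_succ]
  · refine Finset.sum_congr rfl fun w hw => Finset.sum_congr rfl fun i _ => if_pos ?_
    obtain ⟨-, a, ha, ha0⟩ := mem_mixedSeqs.1 hw
    exact ⟨a, List.mem_append_left _ ha, ha0⟩

variable {l N : ℕ}

theorem sub_one_mul_sum_letters (h : l + 1 ≤ N) :
    (v - 1) * ∑ i ∈ Finset.range N, (u ^ (if l < i then 1 else 0) * v ^ i *
        z ^ (if i = 0 then 1 else 0)) =
      (z - 1) * (v - 1) + (v ^ (l + 1) - 1) + u * (v ^ N - v ^ (l + 1)) := by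
  have hlow : ∑ i ∈ Finset.range (l + 1), (u ^ (if l < i then 1 else 0) * v ^ i *
      z ^ (if i = 0 then 1 else 0)) = (z - 1) + ∑ i ∈ Finset.range (l + 1), v ^ i := by
    rw [Finset.sum_range_succ', Finset.sum_range_succ' (fun i => v ^ i)]
    have hterm : ∀ i ∈ Finset.range l, u ^ (if l < i + 1 then 1 else 0) * v ^ (i + 1) *
        z ^ (if i + 1 = 0 then 1 else 0) = v ^ (i + 1) := fun i hi => by
      have hi := Finset.mem_range.1 hi
      rw [if_neg (by omega), if_neg (by omega), pow_zero, pow_zero, one_mul, mul_one]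
    rw [Finset.sum_congr rfl hterm, if_neg (Nat.not_lt_zero l), if_pos rfl]
    ring
  have hhigh : ∑ i ∈ Finset.Ico (l + 1) N, (u ^ (if l < i then 1 else 0) * v ^ i *
      z ^ (if i = 0 then 1 else 0)) = u * ∑ i ∈ Finset.Ico (l + 1) N, v ^ i := by
    rw [Finset.mul_sum]
    refine Finset.sum_congr rfl fun i hi => ?_
    have hi := (Finset.mem_Ico.1 hi).1
    rw [if_pos (by omega), if_neg (by omega), pow_one, pow_zero, mul_one]
  rw [← Finset.sum_range_add_sum_Ico _ h, hlow, hhigh]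
  linear_combination mul_geom_sum v (l + 1) + u * geom_sum_Ico_mul v h

theorem sub_one_mul_sum_weight {w : List ℕ} (hw : IsAscentSeq w) (hmixed : ∃ a ∈ w, a ≠ 0) :
    (v - 1) * ∑ i ∈ Finset.range (letterBound w + 1), weight u v z x (w ++ [i]) =
      (z * (v - 1) - v) * weight u 1 z x w + v * (1 - u) * weight u v z x w +
        u * v ^ 2 * weight (u * v) 1 z x w := by
  have hne : w ≠ [] := List.ne_nil_of_mem hmixed.choose_spec.1
  have hterm : ∀ i, weight u v z x (w ++ [i]) = (u ^ asc w * z ^ w.count 0 * x ^ run w) *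
      (u ^ (if w.getLastD 0 < i then 1 else 0) * v ^ i * z ^ (if i = 0 then 1 else 0)) := by
    intro i
    rw [weight, asc_concat hne, List.getLastD_concat, run_concat hmixed, List.count_append,
      List.count_singleton, pow_add, pow_add]
    simp only [beq_iff_eq]
    ring
  have hlast := hw.getLastD_lt_letterBound hne
  have hbound : letterBound w + 1 = asc w + 2 := by
    rw [letterBound, if_neg hne]
    ring
  simp only [hterm]
  rw [← Finset.mul_sum, mul_left_comm, sub_one_mul_sum_letters u v z (by omega), hbound]
  simp only [weight]
  ring

theorem sub_one_mul_extensionSum (n : ℕ) :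
    (v - 1) * extensionSum u v z x n =
      (z * (v - 1) - v) * mixedSum u 1 z x n + v * (1 - u) * mixedSum u v z x n +
        u * v ^ 2 * mixedSum (u * v) 1 z x n := by
  simp only [extensionSum, mixedSum, Finset.mul_sum (mixedSeqs n), ← Finset.sum_add_distrib]
  refine Finset.sum_congr rfl fun w hw => ?_
  obtain ⟨⟨hw, -⟩, hmixed⟩ := mem_mixedSeqs.1 hw
  exact sub_one_mul_sum_weight u v z x hw hmixed

end Weight

/-! ### The functional equation and its solution -/

section Denominators

variable {R : Type*} [CommRing R] (t u z : R)

theorem delta_zero : delta t u 0 = 1 := by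
  rw [delta]
  ring

theorem delta_one : delta t u 1 = 1 + t * (u - 1) := by
  rw [delta]
  ring

theorem delta_succ (k : ℕ) : delta t u (k + 1) = delta t u k + t * (u - delta t u k) := by
  rw [delta, delta]
  ring

theorem delta_sub (k : ℕ) : delta t u k - u = (1 - t) ^ k * (1 - u) := by
  rw [delta]
  ring

theorem gamma_succ (k : ℕ) :
    gamma t u z (k + 1) = delta t u k + z * t * (u - delta t u k) := by
  rw [gamma, if_neg k.succ_ne_zero, Nat.add_sub_cancel, delta]
  ring

theorem term_eq (s : ℕ) :
    term t u z s = u ^ s * Ring.inverse (∏ i ∈ Finset.Icc 1 (s + 1), gamma t u z i) *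
      ((1 - t) ^ s * Ring.inverse (delta t u s) * Ring.inverse (delta t u (s + 1))) := by
  rw [term, denom, Ring.mul_inverse_rev, Ring.mul_inverse_rev]
  ring

end Denominators

open MvPowerSeries

variable {σ R : Type*} [CommRing R] {t : MvPowerSeries σ R}

theorem isUnit_of_constantCoeff_eq_one {a : MvPowerSeries σ R} (h : constantCoeff a = 1) :
    IsUnit a :=
  isUnit_iff_constantCoeff.2 (h ▸ isUnit_one)

theorem isUnit_delta (ht : constantCoeff t = 0) (u : MvPowerSeries σ R) (k : ℕ) :
    IsUnit (delta t u k) :=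
  isUnit_of_constantCoeff_eq_one (by simp [delta, ht])

theorem isUnit_gamma (ht : constantCoeff t = 0) (u z : MvPowerSeries σ R) (k : ℕ) :
    IsUnit (gamma t u z k) := by
  refine isUnit_of_constantCoeff_eq_one ?_
  unfold gamma
  split_ifs <;> simp [ht]

theorem isUnit_denom (ht : constantCoeff t = 0) (u z : MvPowerSeries σ R) (s : ℕ) :
    IsUnit (denom t u z s) :=
  ((isUnit_delta ht u s).mul (isUnit_delta ht u (s + 1))).mul
    (IsUnit.prod_iff.2 fun i _ => isUnit_gamma ht u z i)

theorem isUnit_prefactor (ht : constantCoeff t = 0) {v : MvPowerSeries σ R}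
    (hv : constantCoeff v = 0) (u z x : MvPowerSeries σ R) :
    IsUnit ((1 - t * z * x) * (v * delta t u 1 - 1)) :=
  isUnit_iff_constantCoeff.2 (by simp [ht, hv])

variable [TopologicalSpace R]

theorem summable_pow_mul {f : MvPowerSeries σ R} (hf : constantCoeff f = 0)
    (g : ℕ → MvPowerSeries σ R) : Summable fun n => f ^ n * g n := by
  refine WithPiTopology.summable_of_tendsto_order_atTop_nhds_top ?_
  rw [ENat.tendsto_nhds_top_iff_natCast_lt]
  intro n
  filter_upwards [Filter.eventually_gt_atTop n] with m hm
  calc (n : ℕ∞) < m := ENat.natCast_lt_natCast.2 hm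
    _ ≤ (f ^ m).order := le_order_pow_of_constantCoeff_eq_zero m hf
    _ ≤ (f ^ m).order + (g m).order := le_self_add
    _ ≤ (f ^ m * g m).order := le_order_mul

theorem summable_term {u : MvPowerSeries σ R} (hu : constantCoeff u = 0)
    (t z : MvPowerSeries σ R) : Summable fun s => term t u z s := by
  simpa only [term, mul_assoc] using summable_pow_mul hu _

/-- The generating function of the ascent sequences `0, …, 0, 1` with at least one `0`, without
the factor `u * v` that marks the ascent and the last letter. -/
def startGF (t z x : MvPowerSeries σ R) : MvPowerSeries σ R :=
  t ^ 2 * z * x * Ring.inverse (1 - t * z * x)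

/-- The generating function of the ascent sequences with a non-zero letter; `t` marks the
length. -/
def mixedGF (t u v z x : MvPowerSeries σ R) : MvPowerSeries σ R :=
  ∑' n, t ^ n * mixedSum u v z x n

/-- The generating function of the ascent sequences that still have a non-zero letter when the
last letter is removed; `t` marks the length after the removal. -/
def extensionGF (t u v z x : MvPowerSeries σ R) : MvPowerSeries σ R :=
  ∑' n, t ^ n * extensionSum u v z x n

theorem hasSum_mixedGF (ht : constantCoeff t = 0) (u v z x : MvPowerSeries σ R) :
    HasSum (fun n => t ^ n * mixedSum u v z x n) (mixedGF t u v z x) :=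
  (summable_pow_mul ht _).hasSum

theorem hasSum_extensionGF (ht : constantCoeff t = 0) (u v z x : MvPowerSeries σ R) :
    HasSum (fun n => t ^ n * extensionSum u v z x n) (extensionGF t u v z x) :=
  (summable_pow_mul ht _).hasSum

/-- What is left of `mixedGF t u 1 z x` after `N` kernel substitutions. -/
def remainder (t u z x : MvPowerSeries σ R) (N : ℕ) : MvPowerSeries σ R :=
  u ^ N * (Ring.inverse (∏ i ∈ Finset.Icc 1 N, gamma t u z i) *
    (Ring.inverse (delta t u N) * mixedGF t (u * Ring.inverse (delta t u N)) 1 z x))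

variable [IsTopologicalRing R]

theorem tendsto_remainder {u : MvPowerSeries σ R} (hu : constantCoeff u = 0)
    (t z x : MvPowerSeries σ R) :
    Filter.Tendsto (remainder t u z x) Filter.atTop (nhds 0) :=
  (summable_pow_mul hu fun N => Ring.inverse (∏ i ∈ Finset.Icc 1 N, gamma t u z i) *
    (Ring.inverse (delta t u N) *
      mixedGF t (u * Ring.inverse (delta t u N)) 1 z x)).tendsto_atTop_zero

variable [T2Space R]

theorem hasSum_pow {f : MvPowerSeries σ R} (hf : constantCoeff f = 0) :
    HasSum (fun n : ℕ => f ^ n) (Ring.inverse (1 - f)) := by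
  have hgeom := WithPiTopology.one_sub_mul_tsum_pow_of_constantCoeff_eq_zero hf
  have hinv : Ring.inverse (1 - f) = ∑' n : ℕ, f ^ n := by
    rw [← mul_one (Ring.inverse _), Ring.inverse_mul_eq_iff_eq_mul _ _ _
      (IsUnit.of_mul_eq_one _ hgeom), hgeom]
  exact hinv ▸ (WithPiTopology.summable_pow_of_constantCoeff_eq_zero hf).hasSum

theorem mixedGF_eq_add_extensionGF (ht : constantCoeff t = 0) (u v z x : MvPowerSeries σ R) :
    mixedGF t u v z x = u * v * startGF t z x + t * extensionGF t u v z x := by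
  have hmixed : HasSum (fun n => t ^ (n + 2) * mixedSum u v z x (n + 2)) (mixedGF t u v z x) := by
    simpa [Finset.sum_range_succ, mixedSum_zero, mixedSum_one] using
      (hasSum_nat_add_iff' 2).2 (hasSum_mixedGF ht u v z x)
  have hext : HasSum (fun n => t ^ (n + 1) * extensionSum u v z x (n + 1))
      (extensionGF t u v z x) := by
    simpa [extensionSum_zero] using (hasSum_nat_add_iff' 1).2 (hasSum_extensionGF ht u v z x)
  have hstart := hasSum_pow (show constantCoeff (t * z * x) = 0 by simp [ht])
  have hterm : ∀ n, t ^ (n + 2) * mixedSum u v z x (n + 2) = u * v * (t ^ 2 * z * x) *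
      (t * z * x) ^ n + t * (t ^ (n + 1) * extensionSum u v z x (n + 1)) := fun n => by
    rw [mixedSum_succ u v z x (n := n + 1) n.succ_ne_zero]
    ring
  rw [funext hterm] at hmixed
  rw [startGF, ← mul_assoc (u * v)]
  exact hmixed.unique ((hstart.mul_left _).add (hext.mul_left t))

theorem sub_one_mul_extensionGF (ht : constantCoeff t = 0) (u v z x : MvPowerSeries σ R) :
    (v - 1) * extensionGF t u v z x =
      (z * (v - 1) - v) * mixedGF t u 1 z x + v * (1 - u) * mixedGF t u v z x +
        u * v ^ 2 * mixedGF t (u * v) 1 z x := by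
  refine ((hasSum_extensionGF ht u v z x).mul_left (v - 1)).unique ?_
  convert (((hasSum_mixedGF ht u 1 z x).mul_left (z * (v - 1) - v)).add
    ((hasSum_mixedGF ht u v z x).mul_left (v * (1 - u)))).add
    ((hasSum_mixedGF ht (u * v) 1 z x).mul_left (u * v ^ 2)) using 2 with n
  linear_combination t ^ n * sub_one_mul_extensionSum u v z x n

theorem mixedGF_functional (ht : constantCoeff t = 0) (u v z x : MvPowerSeries σ R) :
    (v * delta t u 1 - 1) * mixedGF t u v z x =
      (v - 1) * (u * v) * startGF t z x + t * (z * (v - 1) - v) * mixedGF t u 1 z x +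
        t * (u * v ^ 2) * mixedGF t (u * v) 1 z x := by
  have hmixed := mixedGF_eq_add_extensionGF ht u v z x
  have hext := sub_one_mul_extensionGF ht u v z x
  rw [delta_one]
  linear_combination (v - 1) * hmixed + t * hext

/-- The substitution of the root of the kernel into `mixedGF_functional` leaves a factor `t`, which
need not be cancellable; hence the detour through `extensionGF`. -/
theorem mixedGF_kernel (ht : constantCoeff t = 0) {u v : MvPowerSeries σ R}
    (hv : v * delta t u 1 = 1) (z x : MvPowerSeries σ R) :
    (1 + z * t * (u - 1)) * mixedGF t u 1 z x =
      u * v * mixedGF t (u * v) 1 z x + (1 - u) * (u * v) * startGF t z x := by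
  have hmixed := mixedGF_eq_add_extensionGF ht u v z x
  have hext := sub_one_mul_extensionGF ht u v z x
  rw [delta_one] at hv
  linear_combination (1 + t * (u - 1)) * hext + (1 + t * (u - 1)) * v * (1 - u) * hmixed +
    ((z - 1) * mixedGF t u 1 z x + u * v * mixedGF t (u * v) 1 z x +
      (1 - u) * u * v * startGF t z x - (1 + t * (u - 1)) * extensionGF t u v z x) * hv

theorem gamma_mul_mixedGF (ht : constantCoeff t = 0) (u z x : MvPowerSeries σ R) (N : ℕ) :
    gamma t u z (N + 1) *
        (Ring.inverse (delta t u N) * mixedGF t (u * Ring.inverse (delta t u N)) 1 z x) =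
      startGF t z x * u * (1 - u) *
          ((1 - t) ^ N * Ring.inverse (delta t u N) * Ring.inverse (delta t u (N + 1))) +
        u * (Ring.inverse (delta t u (N + 1)) *
          mixedGF t (u * Ring.inverse (delta t u (N + 1))) 1 z x) := by
  have hinv := Ring.mul_inverse_cancel _ (isUnit_delta ht u N)
  have hinv' := Ring.mul_inverse_cancel _ (isUnit_delta ht u (N + 1))
  have hδ := delta_sub t u N
  have hδ' := delta_succ t u N
  rw [gamma_succ]
  generalize delta t u N = d, delta t u (N + 1) = d' at *
  generalize Ring.inverse d = D, Ring.inverse d' = D' at *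
  have hroot : d * D' * delta t (u * D) 1 = 1 := by
    -- `δ_N / δ_{N+1}` is the root of the kernel for the parameter `u / δ_N`.
    rw [delta_one]
    linear_combination hinv' - D' * hδ' + t * u * D' * hinv
  have hkernel := mixedGF_kernel ht hroot z x
  rw [show u * D * (d * D') = u * D' by linear_combination u * D' * hinv] at hkernel
  generalize mixedGF t (u * D) 1 z x = K, mixedGF t (u * D') 1 z x = K' at *
  linear_combination hkernel + ((1 - z * t) * K - u * D' * startGF t z x) * hinv +
    u * D * D' * startGF t z x * hδ

theorem remainder_eq_add (ht : constantCoeff t = 0) (u z x : MvPowerSeries σ R) (N : ℕ) :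
    remainder t u z x N =
      startGF t z x * u * (1 - u) * term t u z N + remainder t u z x (N + 1) := by
  have hstep := gamma_mul_mixedGF ht u z x N
  have hinv := Ring.mul_inverse_cancel _ (isUnit_gamma ht u z (N + 1))
  rw [remainder, remainder, term_eq, Finset.prod_Icc_succ_top (by omega), Ring.mul_inverse_rev]
  generalize Ring.inverse (gamma t u z (N + 1)) = g at *
  generalize Ring.inverse (∏ i ∈ Finset.Icc 1 N, gamma t u z i) = p
  generalize Ring.inverse (delta t u N) * mixedGF t (u * Ring.inverse (delta t u N)) 1 z x = K at *
  linear_combination u ^ N * p * g * hstep - u ^ N * p * K * hinv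

theorem mixedGF_one_eq (ht : constantCoeff t = 0) {u : MvPowerSeries σ R}
    (hu : constantCoeff u = 0) (z x : MvPowerSeries σ R) :
    mixedGF t u 1 z x = startGF t z x * u * (1 - u) * ∑' s, term t u z s := by
  have hseries := ((summable_term hu t z).hasSum.mul_left
    (startGF t z x * u * (1 - u))).tendsto_sum_nat
  have hzero : remainder t u z x 0 = mixedGF t u 1 z x := by simp [remainder, delta_zero]
  have htelescope : ∀ N, ∑ s ∈ Finset.range N, startGF t z x * u * (1 - u) * term t u z s =
      mixedGF t u 1 z x - remainder t u z x N := fun N => by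
    rw [← hzero, ← Finset.sum_range_sub']
    exact Finset.sum_congr rfl fun s _ => by rw [remainder_eq_add ht, add_sub_cancel_right]
  simp only [htelescope] at hseries
  simpa using tendsto_nhds_unique ((tendsto_remainder hu t z x).const_sub _) hseries

theorem mixedGF_eq (ht : constantCoeff t = 0) {u v : MvPowerSeries σ R}
    (hu : constantCoeff u = 0) (hv : constantCoeff v = 0) (z x : MvPowerSeries σ R) :
    mixedGF t u v z x =
      t ^ 2 * z * x * u * Ring.inverse ((1 - t * z * x) * (v * delta t u 1 - 1)) *
        (v * (v - 1) + t * (1 - u) * (z * (v - 1) - v) * (∑' s, term t u z s) +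
          u * v ^ 3 * t * (1 - u * v) * (∑' s, term t (u * v) z s)) := by
  have hfun := mixedGF_functional ht u v z x
  have huv : constantCoeff (u * v) = 0 := by simp [hu]
  have hstart : (1 - t * z * x) * startGF t z x = t ^ 2 * z * x := by
    rw [startGF, mul_left_comm, Ring.mul_inverse_cancel _
      (isUnit_of_constantCoeff_eq_one (by simp [ht])), mul_one]
  rw [mixedGF_one_eq ht hu, mixedGF_one_eq ht huv] at hfun
  rw [mul_right_comm, Ring.eq_mul_inverse_iff_mul_eq _ _ _ (isUnit_prefactor ht hv u z x)]
  generalize (∑' s, term t u z s) = S at *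
  generalize (∑' s, term t (u * v) z s) = T at *
  linear_combination (1 - t * z * x) * hfun + u * (v * (v - 1) +
    t * (1 - u) * (z * (v - 1) - v) * S + u * v ^ 3 * t * (1 - u * v) * T) * hstart

/-! ### The generating function of all ascent sequences -/

theorem coeff_X_pow_mul_weight (d : Fin 5 →₀ ℕ) (w : List ℕ) :
    coeff d (X 0 ^ w.length * weight (X 1) (X 2) (X 3) (X 4) w : MvPowerSeries (Fin 5) ℤ) =
      if w.length = d 0 ∧ asc w = d 1 ∧ w.getLastD 0 = d 2 ∧ w.count 0 = d 3 ∧ run w = d 4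
      then 1 else 0 := by
  classical
  simp only [weight, X_pow_eq, monomial_mul_monomial, mul_one, coeff_monomial]
  refine if_congr ?_ rfl rfl
  rw [Finsupp.ext_iff, Fin.forall_fin_succ, Fin.forall_fin_succ, Fin.forall_fin_succ,
    Fin.forall_fin_succ, Fin.forall_fin_succ]
  simp [Finsupp.single_apply, eq_comm]

theorem hasSum_ascentGF :
    HasSum (fun n => X 0 ^ n * ∑ w ∈ ascentSeqs n, weight (X 1) (X 2) (X 3) (X 4) w) ascentGF := by
  have hlength : ∀ n, X 0 ^ n * ∑ w ∈ ascentSeqs n, weight (X 1) (X 2) (X 3) (X 4) w =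
      ∑ w ∈ ascentSeqs n, X 0 ^ w.length *
        (weight (X 1) (X 2) (X 3) (X 4) w : MvPowerSeries (Fin 5) ℤ) := fun n => by
    rw [Finset.mul_sum]
    exact Finset.sum_congr rfl fun w hw => by rw [(mem_ascentSeqs.1 hw).2]
  rw [WithPiTopology.hasSum_iff_hasSum_coeff]
  intro d
  simp only [hlength, map_sum, coeff_X_pow_mul_weight]
  convert hasSum_single (d 0) ?_ using 1
  · rw [Finset.sum_boole]
    change ((Set.ncard _ : ℕ) : ℤ) = _
    rw [← Set.ncard_coe_finset]
    congr 2
    ext w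
    simp only [Finset.coe_filter, Set.mem_ofPred_eq, mem_ascentSeqs]
    tauto
  · intro n hn
    refine Finset.sum_eq_zero fun w hw => if_neg fun h => hn ?_
    rw [← h.1, (mem_ascentSeqs.1 hw).2]

theorem ascentGF_eq_add_mixedGF :
    ascentGF = Ring.inverse (1 - X 0 * X 3) + mixedGF (X 0) (X 1) (X 2) (X 3) (X 4) := by
  have h03 : constantCoeff (X 0 * X 3 : MvPowerSeries (Fin 5) ℤ) = 0 := by simp
  have hmixed := hasSum_mixedGF (constantCoeff_X 0) (X 1) (X 2) (X 3)
    (X 4 : MvPowerSeries (Fin 5) ℤ)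
  refine hasSum_ascentGF.unique ?_
  convert (hasSum_pow h03).add hmixed using 2 with n
  rw [sum_ascentSeqs, weight_replicate, mul_add, mul_pow, mixedSum]

end TwoPlusTwo

end

/-- Identity in `ℤ⟦t, u, v, z, x⟧`, with `ℤ` discrete and the topology of coefficientwise
convergence; all denominators are units and both series converge. -/
theorem theorem3p2 (t u v z x : MvPowerSeries (Fin 5) ℤ)
    (ht : t = MvPowerSeries.X 0) (hu : u = MvPowerSeries.X 1) (hv : v = MvPowerSeries.X 2)
    (hz : z = MvPowerSeries.X 3) (hx : x = MvPowerSeries.X 4) :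
    IsUnit (1 - t * z) ∧
    IsUnit ((1 - t * z * x) * (v * TwoPlusTwo.delta t u 1 - 1)) ∧
    (∀ s : ℕ, IsUnit (TwoPlusTwo.denom t u z s) ∧ IsUnit (TwoPlusTwo.denom t (u * v) z s)) ∧
    Summable (fun s : ℕ => TwoPlusTwo.term t u z s) ∧
    Summable (fun s : ℕ => TwoPlusTwo.term t (u * v) z s) ∧
    TwoPlusTwo.posetGF =
      Ring.inverse (1 - t * z) +
        t ^ 2 * z * x * u *
            Ring.inverse ((1 - t * z * x) * (v * TwoPlusTwo.delta t u 1 - 1)) *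
          (v * (v - 1)
            + t * (1 - u) * (z * (v - 1) - v) * (∑' s : ℕ, TwoPlusTwo.term t u z s)
            + u * v ^ 3 * t * (1 - u * v) * (∑' s : ℕ, TwoPlusTwo.term t (u * v) z s)) ∧
    TwoPlusTwo.ascentGF = TwoPlusTwo.posetGF := by
  have ht₀ : t.constantCoeff = 0 := by simp [ht]
  have hu₀ : u.constantCoeff = 0 := by simp [hu]
  have hv₀ : v.constantCoeff = 0 := by simp [hv]
  have huv₀ : (u * v).constantCoeff = 0 := by simp [hu]
  refine ⟨TwoPlusTwo.isUnit_of_constantCoeff_eq_one (by simp [ht]),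
    TwoPlusTwo.isUnit_prefactor ht₀ hv₀ u z x,
    fun s => ⟨TwoPlusTwo.isUnit_denom ht₀ u z s, TwoPlusTwo.isUnit_denom ht₀ (u * v) z s⟩,
    TwoPlusTwo.summable_term hu₀ t z, TwoPlusTwo.summable_term huv₀ t z, ?_,
    TwoPlusTwo.ascentGF_eq_posetGF⟩
  rw [← TwoPlusTwo.ascentGF_eq_posetGF, ← TwoPlusTwo.mixedGF_eq ht₀ hu₀ hv₀ z x,
    TwoPlusTwo.ascentGF_eq_add_mixedGF, ht, hu, hv, hz, hx]
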